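/- Let $n \ge 3$ and equip $S^{n-1} = \{x \in \mathbb{R}^n : \|x\| = 1\}$ with its rotation-invariant (Lebesgue) probability measure. For $\delta \in [-1,1]$ let $T_\delta$ be the bounded operator on the complex Hilbert space $L^2(S^{n-1})$ for which $(T_\delta f)(x)$ is, for almost every $x$, the average of $f$ over $\{y \in S^{n-1} : \langle x, y\rangle = \delta\}$ with respect to its rotation-invariant probability measure. For $p \in [1,\infty)$ let $S^p$ be the Schatten class of bounded operators $T$ on $L^2(S^{n-1})$ with $\|T\|_{S^p} = \mathrm{Tr}(|T|^p)^{1/p} < \infty$, and let $S^\infty$ be the space of compact operators with the operator norm. Let $p \in (2 + \frac{2}{n-2}, \infty]$. Then: 1. $T_\delta \in S^p$ for every $\delta \in (-1,1)$. 2. There are constants $C_p \ge 2$ and $\alpha_p \in (0,1)$, depending only on $n$ and $p$, such that for all $\delta \in [-\frac12, \frac12]$ $$\|T_0 - T_\delta\|_{S^p} \le C_p |\delta|^{\alpha_p}.$$ -/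

import Mathlib

open MeasureTheory Metric Set
open scoped ENNReal Pointwise

namespace SphereMean

section Uniform

variable (E : Type*) [NormedAddCommGroup E] [InnerProductSpace ℝ E] [FiniteDimensional ℝ E]
  [MeasurableSpace E] [BorelSpace E]

/-- The rotation-invariant (Lebesgue) probability measure on the unit sphere of `E`: the surface
measure `volume.toSphere` divided by its total mass. -/
noncomputable def uniformSphere : Measure (sphere (0 : E) 1) :=
  ((volume : Measure E).toSphere univ)⁻¹ • (volume : Measure E).toSphere

instance [Nontrivial E] : IsProbabilityMeasure (uniformSphere E) := by
  refine ⟨?_⟩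
  rw [uniformSphere, Measure.smul_apply, smul_eq_mul]
  refine ENNReal.inv_mul_cancel ?_ (measure_ne_top _ _)
  exact (Measure.measure_univ_ne_zero).2 (Measure.toSphere_ne_zero _)

variable {E}

/-- Invariance of a measure under all orthogonal hyperplane reflections. -/
def ReflInvariant (ν : Measure E) : Prop :=
  ∀ v : E, ν.map (ℝ ∙ v)ᗮ.reflection = ν

theorem refl_apply (v z : E) :
    (ℝ ∙ v)ᗮ.reflection z = z - (2 * (inner ℝ v z / ‖v‖ ^ 2)) • v := by
  rw [Submodule.reflection_orthogonal_apply, Submodule.reflection_singleton_apply]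
  simp [mul_smul, two_smul]

theorem charFun_eq_of_norm {ν : Measure E} (h : ReflInvariant ν) {s t : E} (hst : ‖s‖ = ‖t‖) :
    charFun ν s = charFun ν t := by
  conv_lhs => rw [← h (s - t)]
  rw [charFun_apply, charFun_apply, integral_map (by fun_prop) (by fun_prop)]
  congr with x
  congr 3
  have h1 := LinearIsometryEquiv.inner_map_map (ℝ ∙ (s - t))ᗮ.reflection x
    ((ℝ ∙ (s - t))ᗮ.reflection s)
  rw [Submodule.reflection_reflection] at h1
  rw [h1, Submodule.reflection_sub hst]

theorem eq_of_reflInvariant {ν ν' : Measure E} [IsProbabilityMeasure ν] [IsProbabilityMeasure ν']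
    (h : ReflInvariant ν) (h' : ReflInvariant ν')
    (hν : ∀ᵐ x ∂ν, ‖x‖ = 1) (hν' : ∀ᵐ x ∂ν', ‖x‖ = 1) : ν = ν' := by
  apply Measure.ext_of_charFun
  ext t
  have key : ∀ {ρ ρ' : Measure E} [IsProbabilityMeasure ρ] [IsProbabilityMeasure ρ'],
      ReflInvariant ρ → (∀ᵐ x ∂ρ', ‖x‖ = 1) →
      ∫ y, charFun ρ (‖t‖ • y) ∂ρ' = charFun ρ t := by
    intro ρ ρ' _ _ hρ hρ'
    have : ∀ᵐ y ∂ρ', charFun ρ (‖t‖ • y) = charFun ρ t := by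
      filter_upwards [hρ'] with y hy
      exact charFun_eq_of_norm hρ (by simp [norm_smul, hy])
    rw [integral_congr_ae this]
    simp
  rw [← key h hν', ← key h' hν]
  simp only [charFun_apply]
  rw [integral_integral_swap]
  · congr with x
    congr with y
    congr 3
    rw [inner_smul_right, inner_smul_right, real_inner_comm]
  · refine Integrable.of_bound (C := 1) (by fun_prop) (.of_forall fun z => ?_)
    simp only [Function.uncurry]
    rw [Complex.norm_exp_ofReal_mul_I]

theorem map_uniformSphere_refl : ReflInvariant ((uniformSphere E).map Subtype.val) := by
  intro v
  set R := (ℝ ∙ v)ᗮ.reflection with hR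
  ext A hA
  rw [Measure.map_apply (by fun_prop) hA, Measure.map_apply (by fun_prop) (by measurability),
    Measure.map_apply (by fun_prop) hA]
  simp only [uniformSphere, Measure.smul_apply]
  congr 1
  rw [Measure.toSphere_apply' _ (measurable_subtype_coe (by measurability)),
    Measure.toSphere_apply' _ (measurable_subtype_coe hA)]
  congr 1
  have : Ioo (0:ℝ) 1 • (Subtype.val '' (Subtype.val ⁻¹' (R ⁻¹' A) : Set (sphere (0:E) 1)))
      = R ⁻¹' (Ioo (0:ℝ) 1 • (Subtype.val '' (Subtype.val ⁻¹' A : Set (sphere (0:E) 1)))) := by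
    ext z
    simp only [Set.mem_smul, Subtype.image_preimage_coe, mem_inter_iff, mem_preimage,
      mem_sphere_iff_norm, sub_zero]
    constructor
    · rintro ⟨r, hr, w, ⟨hw, hw'⟩, rfl⟩
      exact ⟨r, hr, R w, ⟨by simpa using hw, hw'⟩, by simp⟩
    · rintro ⟨r, hr, w, ⟨hw, hw'⟩, h⟩
      refine ⟨r, hr, R.symm w, ⟨by simpa using hw, by simpa using hw'⟩, ?_⟩
      rw [← map_smul, h]; simp
  rw [this]
  exact (LinearIsometryEquiv.measurePreserving R).measure_preimage_emb
    R.toHomeomorph.measurableEmbedding _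

theorem map_uniformSphere_norm : ∀ᵐ x ∂(uniformSphere E).map Subtype.val, ‖x‖ = 1 := by
  rw [ae_map_iff (by fun_prop) (measurableSet_eq_fun (by fun_prop) (by fun_prop))]
  exact .of_forall fun x => by simp

/-- The uniform probability measure on the unit ball (only used in proofs). -/
noncomputable def ballProb (E : Type*) [NormedAddCommGroup E] [InnerProductSpace ℝ E]
    [FiniteDimensional ℝ E] [MeasurableSpace E] [BorelSpace E] : Measure E :=
  ProbabilityTheory.cond volume (ball (0 : E) 1)

instance : IsProbabilityMeasure (ballProb E) :=
  ProbabilityTheory.cond_isProbabilityMeasure_of_finite (measure_ball_pos _ _ one_pos).ne'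
    measure_ball_lt_top.ne

theorem ballProb_refl : ReflInvariant (ballProb E) := by
  intro v
  set R := (ℝ ∙ v)ᗮ.reflection with hR
  ext A hA
  rw [Measure.map_apply (by fun_prop) hA, ballProb, ProbabilityTheory.cond_apply measurableSet_ball,
    ProbabilityTheory.cond_apply measurableSet_ball]
  congr 1
  have : ball (0:E) 1 ∩ R ⁻¹' A = R ⁻¹' (ball (0:E) 1 ∩ A) := by
    ext z; simp
  rw [this]
  exact (LinearIsometryEquiv.measurePreserving R).measure_preimage_emb
    R.toHomeomorph.measurableEmbedding _

theorem ballProb_span (hE : 2 ≤ Module.finrank ℝ E) (x : E) :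
    ∀ᵐ z ∂ballProb E, z ∉ (ℝ ∙ x) := by
  have h : (volume : Measure E) ((ℝ ∙ x : Submodule ℝ E) : Set E) = 0 := by
    apply Measure.addHaar_submodule
    intro h
    have h1 := finrank_span_le_card (R := ℝ) ({x} : Set E)
    rw [h, finrank_top] at h1
    simp at h1
    omega
  exact (ProbabilityTheory.cond_absolutelyContinuous) (by simpa [compl_ofPred] using h)

/-- An auxiliary map, only used in proofs: `δ x + √(1 - δ²) w / ‖w‖`, with `w` the component of `z`
orthogonal to the unit vector `x`. -/
noncomputable def slicePt (δ : ℝ) (x z : E) : E :=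
  δ • x + √(1 - δ ^ 2) • (‖z - inner ℝ x z • x‖⁻¹ • (z - inner ℝ x z • x))

/-- The map `u ↦ δ x + √(1 - δ²) u` from the unit sphere of the hyperplane `xᗮ` to the unit sphere
of `E`; for `|δ| < 1` it is a similarity onto the slice `{y | ⟪x, y⟫ = δ}`, and for `δ = ± 1` it is
constant, equal to `± x`. -/
noncomputable def sliceEmb (δ : Icc (-1 : ℝ) 1) (x : sphere (0 : E) 1)
    (u : sphere (0 : (ℝ ∙ (x : E))ᗮ) 1) : sphere (0 : E) 1 :=
  ⟨(δ : ℝ) • (x : E) + √(1 - (δ : ℝ) ^ 2) • ((u : (ℝ ∙ (x : E))ᗮ) : E), by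
    have hx : ‖(x : E)‖ = 1 := by simp
    have hu : ‖((u : (ℝ ∙ (x : E))ᗮ) : E)‖ = 1 := by
      rw [← Submodule.coe_norm]; simp
    have hxu : inner ℝ (x : E) ((u : (ℝ ∙ (x : E))ᗮ) : E) = 0 :=
      Submodule.mem_orthogonal_singleton_iff_inner_right.1 (u : (ℝ ∙ (x : E))ᗮ).2
    have hδ : 0 ≤ 1 - (δ : ℝ) ^ 2 := by
      have := δ.2.1; have := δ.2.2; nlinarith
    rw [mem_sphere_zero_iff_norm, ← sq_eq_sq₀ (norm_nonneg _) zero_le_one,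
      norm_add_sq_real, norm_smul, norm_smul, inner_smul_left, inner_smul_right, hx, hu, hxu]
    simp [Real.sq_sqrt hδ]⟩

theorem inner_sliceEmb (δ : Icc (-1 : ℝ) 1) (x : sphere (0 : E) 1)
    (u : sphere (0 : (ℝ ∙ (x : E))ᗮ) 1) : inner ℝ (x : E) (sliceEmb δ x u : E) = δ := by
  have hxu : inner ℝ (x : E) ((u : (ℝ ∙ (x : E))ᗮ) : E) = 0 :=
    Submodule.mem_orthogonal_singleton_iff_inner_right.1 (u : (ℝ ∙ (x : E))ᗮ).2
  simp [sliceEmb, inner_add_right, inner_smul_right, hxu]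

/-- The uniform probability measure on the slice `{y | ⟪x, y⟫ = δ}` of the unit sphere. -/
noncomputable def sliceMeasure (δ : Icc (-1 : ℝ) 1) (x : sphere (0 : E) 1) :
    Measure (sphere (0 : E) 1) :=
  (uniformSphere (ℝ ∙ (x : E))ᗮ).map (sliceEmb δ x)

theorem continuous_sliceEmb (δ : Icc (-1 : ℝ) 1) (x : sphere (0 : E) 1) :
    Continuous (sliceEmb δ x) := by
  unfold sliceEmb
  fun_prop

theorem nontrivial_orth (hE : 2 ≤ Module.finrank ℝ E) (x : E) : Nontrivial (ℝ ∙ x)ᗮ := by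
  have h1 := finrank_span_le_card (R := ℝ) ({x} : Set E)
  have h2 := Submodule.finrank_add_finrank_orthogonal (ℝ ∙ x)
  simp at h1
  exact Module.nontrivial_of_finrank_pos (R := ℝ) (by omega)

theorem isProb_slice (hE : 2 ≤ Module.finrank ℝ E) (δ : Icc (-1 : ℝ) 1) (x : sphere (0 : E) 1) :
    IsProbabilityMeasure (sliceMeasure δ x) := by
  have := nontrivial_orth hE (x : E)
  exact Measure.isProbabilityMeasure_map (continuous_sliceEmb δ x).aemeasurable

theorem proj_val (x : E) (hx : ‖x‖ = 1) (z : E) :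
    (((ℝ ∙ x)ᗮ.orthogonalProjectionOnto z : (ℝ ∙ x)ᗮ) : E) = z - inner ℝ x z • x := by
  rw [Submodule.orthogonalProjectionOnto_orthogonal]
  simp [Submodule.starProjection_unit_singleton ℝ hx]

/-- On the unit sphere of `xᗮ`, the uniform measure is the law of the normalized projection. -/
theorem map_uniformSphere_orth (hE : 2 ≤ Module.finrank ℝ E) (x : E) (hx : ‖x‖ = 1) :
    (uniformSphere (ℝ ∙ x)ᗮ).map Subtype.val =
      (ballProb E).map (fun z => ‖(ℝ ∙ x)ᗮ.orthogonalProjectionOnto z‖⁻¹ •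
        (ℝ ∙ x)ᗮ.orthogonalProjectionOnto z) := by
  have := nontrivial_orth hE x
  have hm : Measurable (fun z : E => ‖(ℝ ∙ x)ᗮ.orthogonalProjectionOnto z‖⁻¹ •
        (ℝ ∙ x)ᗮ.orthogonalProjectionOnto z) := by fun_prop
  have : IsProbabilityMeasure ((uniformSphere (ℝ ∙ x)ᗮ).map Subtype.val) :=
    Measure.isProbabilityMeasure_map (by fun_prop)
  have : IsProbabilityMeasure ((ballProb E).map (fun z =>
      ‖(ℝ ∙ x)ᗮ.orthogonalProjectionOnto z‖⁻¹ • (ℝ ∙ x)ᗮ.orthogonalProjectionOnto z)) :=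
    Measure.isProbabilityMeasure_map hm.aemeasurable
  refine eq_of_reflInvariant map_uniformSphere_refl ?_ map_uniformSphere_norm ?_
  · intro v
    conv_rhs => rw [← ballProb_refl (v : E)]
    rw [Measure.map_map (by fun_prop) hm, Measure.map_map hm (by fun_prop)]
    congr 1
    ext1 z
    have hxv : inner ℝ x (v : E) = 0 := Submodule.mem_orthogonal_singleton_iff_inner_right.1 v.2
    have : (ℝ ∙ x)ᗮ.orthogonalProjectionOnto ((ℝ ∙ (v : E))ᗮ.reflection z)
        = (ℝ ∙ v)ᗮ.reflection ((ℝ ∙ x)ᗮ.orthogonalProjectionOnto z) := by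
      ext
      rw [proj_val x hx, refl_apply, refl_apply]
      simp only [Submodule.coe_sub, Submodule.coe_smul, Submodule.coe_norm, Submodule.coe_inner,
        proj_val x hx]
      rw [inner_sub_right, inner_sub_right, inner_smul_right, inner_smul_right, hxv,
        real_inner_comm x (v : E), hxv]
      simp only [mul_zero, sub_zero]
      abel
    simp only [Function.comp_apply, this, LinearIsometryEquiv.norm_map, map_smul]
  · rw [ae_map_iff hm.aemeasurable (measurableSet_eq_fun (by fun_prop) (by fun_prop))]
    filter_upwards [ballProb_span hE x] with z hz
    have : (ℝ ∙ x)ᗮ.orthogonalProjectionOnto z ≠ 0 := by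
      intro h
      apply hz
      have h2 := congrArg Subtype.val h
      rw [proj_val x hx] at h2
      have h3 : z = inner ℝ x z • x := by simpa [sub_eq_zero] using h2
      rw [h3]
      exact Submodule.smul_mem _ _ (Submodule.mem_span_singleton_self x)
    rw [norm_smul, norm_inv, norm_norm, inv_mul_cancel₀ (norm_ne_zero_iff.2 this)]

theorem map_sliceMeasure (hE : 2 ≤ Module.finrank ℝ E) (δ : Icc (-1 : ℝ) 1)
    (x : sphere (0 : E) 1) :
    (sliceMeasure δ x).map Subtype.val = (ballProb E).map (slicePt δ (x : E)) := by
  have hx : ‖(x : E)‖ = 1 := by simp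
  rw [sliceMeasure, Measure.map_map (by fun_prop) (continuous_sliceEmb δ x).measurable]
  have h1 : (Subtype.val ∘ sliceEmb δ x) =
      (fun w : (ℝ ∙ (x : E))ᗮ => (δ : ℝ) • (x : E) + √(1 - (δ : ℝ) ^ 2) • (w : E)) ∘
        (Subtype.val : sphere (0 : (ℝ ∙ (x : E))ᗮ) 1 → _) := rfl
  rw [h1, ← Measure.map_map (by fun_prop) (by fun_prop), map_uniformSphere_orth hE x hx,
    Measure.map_map (by fun_prop) (by fun_prop)]
  congr 1
  ext1 z
  simp only [Function.comp_apply, slicePt, Submodule.coe_smul, Submodule.coe_norm, proj_val (x : E) hx]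

theorem measurable_slicePt (δ : ℝ) : Measurable (fun q : E × E => slicePt δ q.1 q.2) := by
  unfold slicePt
  fun_prop

theorem slicePt_refl (δ : ℝ) (v x z : E) :
    slicePt δ ((ℝ ∙ v)ᗮ.reflection x) ((ℝ ∙ v)ᗮ.reflection z) =
      (ℝ ∙ v)ᗮ.reflection (slicePt δ x z) := by
  have h : (ℝ ∙ v)ᗮ.reflection z - inner ℝ x z • (ℝ ∙ v)ᗮ.reflection x =
      (ℝ ∙ v)ᗮ.reflection (z - inner ℝ x z • x) := by simp
  simp only [slicePt, LinearIsometryEquiv.inner_map_map, h, LinearIsometryEquiv.norm_map]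
  simp only [map_add, map_smul]

theorem map_slicePt_prod (hE : 2 ≤ Module.finrank ℝ E) (δ : Icc (-1 : ℝ) 1) :
    (((uniformSphere E).map Subtype.val).prod (ballProb E)).map (fun q => slicePt δ q.1 q.2) =
      (uniformSphere E).map Subtype.val := by
  have : Nontrivial E := Module.nontrivial_of_finrank_pos (R := ℝ) (by omega)
  have : IsProbabilityMeasure ((uniformSphere E).map Subtype.val) :=
    Measure.isProbabilityMeasure_map (by fun_prop)
  have hm := measurable_slicePt (E := E) δ
  have := Measure.isProbabilityMeasure_map
    (μ := ((uniformSphere E).map Subtype.val).prod (ballProb E)) hm.aemeasurable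
  refine eq_of_reflInvariant ?_ map_uniformSphere_refl ?_ map_uniformSphere_norm
  · intro v
    rw [Measure.map_map (by fun_prop) hm]
    conv_rhs => rw [← map_uniformSphere_refl v, ← ballProb_refl v,
      Measure.map_prod_map _ _ (by fun_prop) (by fun_prop), Measure.map_map hm (by fun_prop)]
    congr 1
    ext1 q
    simp [slicePt_refl]
  · have hms : MeasurableSet {y : E | ‖y‖ = 1} :=
      measurableSet_eq_fun (by fun_prop) (by fun_prop)
    rw [ae_map_iff hm.aemeasurable hms]
    have hp : ((uniformSphere E).map Subtype.val).prod (ballProb E) =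
        ((uniformSphere E).prod (ballProb E)).map (Prod.map Subtype.val id) := by
      rw [← Measure.map_prod_map _ _ (by fun_prop) (by fun_prop), Measure.map_id]
    have hm' : Measurable (fun q : sphere (0 : E) 1 × E => slicePt δ (q.1 : E) q.2) :=
      hm.comp (by fun_prop : Measurable (Prod.map Subtype.val id))
    rw [hp]
    refine (ae_map_iff (by fun_prop : Measurable (Prod.map Subtype.val id)).aemeasurable
      (hm hms)).2 ?_
    refine (Measure.ae_prod_iff_ae_ae (hm' hms)).2 (.of_forall fun x => ?_)
    have h := map_sliceMeasure hE δ x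
    have hx : Measurable (slicePt (δ : ℝ) (x : E)) :=
      hm.comp (measurable_const.prodMk measurable_id)
    change ∀ᵐ y ∂ballProb E, ‖slicePt (δ : ℝ) (x : E) y‖ = 1
    rw [← ae_map_iff (p := fun y => ‖y‖ = 1) hx.aemeasurable hms, ← h,
      ae_map_iff (by fun_prop) hms]
    exact .of_forall fun y => by simp

theorem sphere_emb : MeasurableEmbedding (Subtype.val : sphere (0 : E) 1 → E) :=
  .subtype_coe isClosed_sphere.measurableSet

theorem measurable_slicePt' (δ : ℝ) :
    Measurable (fun q : sphere (0 : E) 1 × E => slicePt δ (q.1 : E) q.2) :=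
  (measurable_slicePt δ).comp (by fun_prop : Measurable (Prod.map Subtype.val id))

theorem lintegral_sliceMeasure (hE : 2 ≤ Module.finrank ℝ E) (δ : Icc (-1 : ℝ) 1)
    {g : E → ℝ≥0∞} (hg : Measurable g) (x : sphere (0 : E) 1) :
    ∫⁻ y, g y ∂sliceMeasure δ x = ∫⁻ z, g (slicePt δ (x : E) z) ∂ballProb E := by
  have hx : Measurable (slicePt (δ : ℝ) (x : E)) :=
    (measurable_slicePt (δ : ℝ)).comp (measurable_const.prodMk measurable_id)
  rw [← lintegral_map hg hx, ← map_sliceMeasure hE,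
    lintegral_map hg (by fun_prop)]

/-- Averaging over slices preserves the uniform measure. -/
theorem lintegral_slice (hE : 2 ≤ Module.finrank ℝ E) (δ : Icc (-1 : ℝ) 1)
    {g : sphere (0 : E) 1 → ℝ≥0∞} (hg : Measurable g) :
    ∫⁻ x, ∫⁻ y, g y ∂sliceMeasure δ x ∂uniformSphere E = ∫⁻ y, g y ∂uniformSphere E := by
  set G : E → ℝ≥0∞ := Function.extend Subtype.val g 0 with hGdef
  have hG : Measurable G := sphere_emb.measurable_extend hg measurable_const
  have hGg : ∀ y : sphere (0 : E) 1, g y = G y := fun y =>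
    (Subtype.val_injective.extend_apply g 0 y).symm
  simp only [hGg, lintegral_sliceMeasure hE δ hG]
  have : Nontrivial E := Module.nontrivial_of_finrank_pos (R := ℝ) (by omega)
  have : IsProbabilityMeasure ((uniformSphere E).map Subtype.val) :=
    Measure.isProbabilityMeasure_map (by fun_prop)
  rw [← lintegral_map (f := G) (g := Subtype.val) hG (by fun_prop), ← map_slicePt_prod hE δ,
    lintegral_map hG (measurable_slicePt _),
    lintegral_prod (fun q : E × E => G (slicePt δ q.1 q.2))
      (hG.comp (measurable_slicePt _)).aemeasurable, sphere_emb.lintegral_map]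

theorem ae_slice (hE : 2 ≤ Module.finrank ℝ E) (δ : Icc (-1 : ℝ) 1)
    {q : sphere (0 : E) 1 → Prop} (hq : ∀ᵐ y ∂uniformSphere E, q y) :
    ∀ᵐ x ∂uniformSphere E, ∀ᵐ y ∂sliceMeasure δ x, q y := by
  obtain ⟨s, hs, hsm, hs0⟩ := exists_measurable_superset_of_null (ae_iff.1 hq)
  have h1 := lintegral_slice hE δ (g := s.indicator 1) (measurable_one.indicator hsm)
  simp only [lintegral_indicator_one hsm, hs0] at h1
  have hmeas : Measurable fun x : sphere (0 : E) 1 => sliceMeasure δ x s := by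
    have hG : Measurable ((Subtype.val '' s : Set E).indicator (1 : E → ℝ≥0∞)) :=
      measurable_one.indicator (sphere_emb.measurableSet_image.2 hsm)
    have : ∀ x : sphere (0 : E) 1, sliceMeasure δ x s =
        ∫⁻ z, (Subtype.val '' s : Set E).indicator 1 (slicePt δ (x : E) z) ∂ballProb E := by
      intro x
      rw [← lintegral_sliceMeasure hE δ hG, ← lintegral_indicator_one hsm]
      congr with y
      by_cases hy : y ∈ s <;> simp [indicator, hy, -mem_sphere_iff_norm]
    simp only [this]
    exact (hG.comp (measurable_slicePt' (δ : ℝ))).lintegral_prod_right'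
  rw [lintegral_eq_zero_iff hmeas] at h1
  filter_upwards [h1] with x hx
  exact measure_mono_null hs hx

theorem stronglyMeasurable_slice (hE : 2 ≤ Module.finrank ℝ E) (δ : Icc (-1 : ℝ) 1)
    {f : sphere (0 : E) 1 → ℂ} (hf : StronglyMeasurable f) :
    StronglyMeasurable fun x => ∫ y, f y ∂sliceMeasure δ x := by
  set F : E → ℂ := Function.extend Subtype.val f 0 with hFdef
  have hF : Measurable F := sphere_emb.measurable_extend hf.measurable measurable_const
  have : ∀ x, ∫ y, f y ∂sliceMeasure δ x = ∫ z, F (slicePt δ (x : E) z) ∂ballProb E := by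
    intro x
    have hx : Measurable (slicePt (δ : ℝ) (x : E)) := 
      (measurable_slicePt (δ : ℝ)).comp (measurable_const.prodMk measurable_id)
    rw [← integral_map (f := F) hx.aemeasurable hF.aestronglyMeasurable, ← map_sliceMeasure hE,
      sphere_emb.integral_map]
    congr with y
    exact (Subtype.val_injective.extend_apply f 0 y).symm
  simp only [this]
  exact StronglyMeasurable.integral_prod_right'
    (f := fun q : sphere (0 : E) 1 × E => F (slicePt δ (q.1 : E) q.2))
    (hF.comp (measurable_slicePt' (δ : ℝ))).stronglyMeasurable

theorem eLpNorm_slice_le (hE : 2 ≤ Module.finrank ℝ E) (δ : Icc (-1 : ℝ) 1)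
    {f : sphere (0 : E) 1 → ℂ} (hf : StronglyMeasurable f) :
    eLpNorm (fun x => ∫ y, f y ∂sliceMeasure δ x) 2 (uniformSphere E) ≤
      eLpNorm f 2 (uniformSphere E) := by
  simp only [eLpNorm_eq_lintegral_rpow_enorm_toReal two_ne_zero ENNReal.ofNat_ne_top]
  refine ENNReal.rpow_le_rpow ?_ (by simp)
  rw [← lintegral_slice hE δ (g := fun y => ‖f y‖ₑ ^ (2 : ℝ≥0∞).toReal)
    (by have := hf.measurable; fun_prop)]
  refine lintegral_mono fun x => ?_
  have := isProb_slice hE δ x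
  have h1 : ‖∫ y, f y ∂sliceMeasure δ x‖ₑ ≤ eLpNorm f 2 (sliceMeasure δ x) :=
    (enorm_integral_le_lintegral_enorm _).trans
      (by
        rw [← eLpNorm_one_eq_lintegral_enorm]
        exact eLpNorm_le_eLpNorm_of_exponent_le one_le_two hf.aestronglyMeasurable)
  refine (ENNReal.rpow_le_rpow h1 ENNReal.toReal_nonneg).trans ?_
  rw [eLpNorm_eq_lintegral_rpow_enorm_toReal two_ne_zero ENNReal.ofNat_ne_top,
    ← ENNReal.rpow_mul]
  simp

theorem ae_integrable_slice (hE : 2 ≤ Module.finrank ℝ E) (δ : Icc (-1 : ℝ) 1)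
    {f : sphere (0 : E) 1 → ℂ} (hf : StronglyMeasurable f) (hfi : MemLp f 2 (uniformSphere E)) :
    ∀ᵐ x ∂uniformSphere E, Integrable f (sliceMeasure δ x) := by
  have : Nontrivial E := Module.nontrivial_of_finrank_pos (R := ℝ) (by omega)
  have hi : Integrable f (uniformSphere E) := hfi.integrable one_le_two
  have h1 := lintegral_slice hE δ (g := fun y => ‖f y‖ₑ) (by fun_prop)
  have hmeas : Measurable fun x : sphere (0 : E) 1 => ∫⁻ y, ‖f y‖ₑ ∂sliceMeasure δ x := by
    set G : E → ℝ≥0∞ := Function.extend Subtype.val (fun y => ‖f y‖ₑ) 0 with hGdef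
    have hG : Measurable G := sphere_emb.measurable_extend (by fun_prop) measurable_const
    have hGg : ∀ y : sphere (0 : E) 1, ‖f y‖ₑ = G y := fun y =>
      (Subtype.val_injective.extend_apply (fun y => ‖f y‖ₑ) 0 y).symm
    simp only [hGg, lintegral_sliceMeasure hE δ hG]
    exact (hG.comp (measurable_slicePt' (δ : ℝ))).lintegral_prod_right'
  filter_upwards [ae_lt_top hmeas (by rw [h1]; exact hi.2.ne)] with x hx
  exact ⟨hf.aestronglyMeasurable, hx⟩

theorem memLp_slice (hE : 2 ≤ Module.finrank ℝ E) (δ : Icc (-1 : ℝ) 1)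
    (f : Lp ℂ 2 (uniformSphere E)) :
    MemLp (fun x => ∫ y, f y ∂sliceMeasure δ x) 2 (uniformSphere E) :=
  ⟨(stronglyMeasurable_slice hE δ (Lp.stronglyMeasurable f)).aestronglyMeasurable,
    (eLpNorm_slice_le hE δ (Lp.stronglyMeasurable f)).trans_lt (Lp.memLp f).2⟩

/-- The spherical averaging operator `T_δ` on the complex space `L²` of the unit sphere:
`(T_δ f)(x)` is, for almost every `x`, the average of `f` over the slice `{y | ⟪x, y⟫ = δ}`. It is
well defined on classes of functions modulo null sets (`ae_slice`), the average exists for almost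
every `x` (`ae_integrable_slice`), and it is a contraction of `L²`. -/
noncomputable def sphereAverage (hE : 2 ≤ Module.finrank ℝ E) (δ : Icc (-1 : ℝ) 1) :
    Lp ℂ 2 (uniformSphere E) →L[ℂ] Lp ℂ 2 (uniformSphere E) :=
  LinearMap.mkContinuous
    { toFun := fun f => (memLp_slice hE δ f).toLp (fun x => ∫ y, f y ∂sliceMeasure δ x)
      map_add' := fun f g => by
        rw [← MemLp.toLp_add, MemLp.toLp_eq_toLp_iff]
        filter_upwards [ae_slice hE δ (Lp.coeFn_add f g),
          ae_integrable_slice hE δ (Lp.stronglyMeasurable f) (Lp.memLp f),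
          ae_integrable_slice hE δ (Lp.stronglyMeasurable g) (Lp.memLp g)] with x h hf hg
        rw [integral_congr_ae h]
        exact integral_add hf hg
      map_smul' := fun c f => by
        rw [RingHom.id_apply, ← MemLp.toLp_const_smul, MemLp.toLp_eq_toLp_iff]
        filter_upwards [ae_slice hE δ (Lp.coeFn_smul c f)] with x h
        rw [integral_congr_ae h]
        exact integral_smul c f }
    1 fun f => by
      rw [one_mul, LinearMap.coe_mk, AddHom.coe_mk, Lp.norm_toLp, Lp.norm_def]
      exact ENNReal.toReal_mono (Lp.memLp f).2.ne
        (eLpNorm_slice_le hE δ (Lp.stronglyMeasurable f))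

theorem coeFn_sphereAverage (hE : 2 ≤ Module.finrank ℝ E) (δ : Icc (-1 : ℝ) 1)
    (f : Lp ℂ 2 (uniformSphere E)) :
    sphereAverage hE δ f =ᵐ[uniformSphere E] fun x => ∫ y, f y ∂sliceMeasure δ x :=
  (memLp_slice hE δ f).coeFn_toLp

end Uniform

/-- The averaging operator `T_δ` on `L²(S^{n-1})`, where `S^{n-1}` is the unit sphere of the
Euclidean space `ℝⁿ`, `n ≥ 3`. -/
noncomputable def avgOp (n : ℕ) (hn : 3 ≤ n) (δ : Icc (-1 : ℝ) 1) :
    Lp ℂ 2 (uniformSphere (EuclideanSpace ℝ (Fin n))) →L[ℂ]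
      Lp ℂ 2 (uniformSphere (EuclideanSpace ℝ (Fin n))) :=
  sphereAverage (by rw [finrank_euclideanSpace_fin]; omega) δ

section Schatten

variable {H : Type*} [NormedAddCommGroup H] [InnerProductSpace ℂ H] [CompleteSpace H]

/-- The trace of a positive operator computed in the Hilbert basis `b`. -/
noncomputable def traceOn {ι : Type*} (b : HilbertBasis ι ℂ H) (A : H →L[ℂ] H) : ℝ≥0∞ :=
  ∑' i, ENNReal.ofReal (inner ℂ (b i) (A (b i))).re

theorem parseval {ι : Type*} (b : HilbertBasis ι ℂ H) (x : H) :
    ∑' i, ENNReal.ofReal (‖inner ℂ (b i) x‖ ^ 2) = ENNReal.ofReal (‖x‖ ^ 2) := by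
  have h := (Complex.hasSum_re (b.hasSum_inner_mul_inner x x))
  have h2 : ∀ i, (inner ℂ x (b i) * inner ℂ (b i) x).re = ‖inner ℂ (b i) x‖ ^ 2 := by
    intro i
    rw [← inner_conj_symm, mul_comm, Complex.mul_conj, Complex.normSq_eq_norm_sq,
      Complex.ofReal_re]
  simp only [h2] at h
  rw [← ENNReal.ofReal_tsum_of_nonneg (fun i => by positivity) h.summable, h.tsum_eq]
  congr 1
  rw [inner_self_eq_norm_sq_to_K]
  norm_cast

theorem traceOn_eq {ι κ : Type*} (b : HilbertBasis ι ℂ H) (c : HilbertBasis κ ℂ H)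
    (A : H →L[ℂ] H) (hA : 0 ≤ A) : traceOn b A = traceOn c A := by
  set S := CFC.sqrt A with hS
  have hSA : S * S = A := CFC.sqrt_mul_sqrt_self A hA
  have hSs : IsSelfAdjoint S := (CFC.sqrt_nonneg A).isSelfAdjoint
  have hsymm := (ContinuousLinearMap.isSelfAdjoint_iff_isSymmetric.1 hSs)
  have key : ∀ x, (inner ℂ x (A x)).re = ‖S x‖ ^ 2 := by
    intro x
    rw [← hSA, mul_apply_eq_comp]
    have := hsymm x (S x)
    simp only [ContinuousLinearMap.coe_coe] at this
    rw [← this, inner_self_eq_norm_sq_to_K]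
    norm_cast
  simp only [traceOn, key]
  simp only [← parseval c (S (b _)), ← parseval b (S (c _))]
  rw [ENNReal.tsum_comm]
  congr with i
  congr with j
  have := hsymm (c i) (b j)
  simp only [ContinuousLinearMap.coe_coe] at this
  rw [← this, norm_inner_symm]

/-- The trace, in `[0, ∞]`, of a positive operator; it does not depend on the Hilbert basis
(`posTrace_eq`). -/
noncomputable def posTrace (A : H →L[ℂ] H) : ℝ≥0∞ :=
  traceOn (exists_hilbertBasis ℂ H).choose_spec.choose A

theorem posTrace_eq {ι : Type*} (b : HilbertBasis ι ℂ H) {A : H →L[ℂ] H} (hA : 0 ≤ A) :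
    posTrace A = ∑' i, ENNReal.ofReal (inner ℂ (b i) (A (b i))).re :=
  traceOn_eq _ b A hA

open Classical in
/-- The Schatten norm `‖T‖_p = Tr(|T|^p)^{1/p}`, with value `∞` when the trace is infinite; the
norm of `S^∞` is the operator norm. -/
noncomputable def schattenNorm (p : ℝ≥0∞) (T : H →L[ℂ] H) : ℝ≥0∞ :=
  if p = ∞ then ‖T‖ₑ else posTrace (CFC.abs T ^ p.toReal) ^ (1 / p.toReal)

/-- Membership in the Schatten class `S^p`: finiteness of the norm for `p < ∞`, and `S^∞` is the
space of compact operators. -/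
def MemSchatten (p : ℝ≥0∞) (T : H →L[ℂ] H) : Prop :=
  if p = ∞ then IsCompactOperator T else schattenNorm p T < ∞

end Schatten
end SphereMean

/-!
The zonal functions `x ↦ φ_k(⟪x, y⟫)`, where `φ_k` is the Gegenbauer polynomial with `φ_k(1) = 1`,
diagonalize all the averages `T_δ` at once: by the product formula they are eigenfunctions of `T_δ`
with eigenvalue `φ_k(δ)`. The zonal functions of degree `k` are reproducing up to the factor `h_k`,
so Bessel's inequality bounds the multiplicity of this eigenvalue by `1 / h_k`, where
`h_k = ∫ φ_k(⟪x, e⟫)² = O(k ^ (-N))` and `N = n - 2`. The energy of the Gegenbauer differential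
equation gives `|φ_k(δ)| = O(√h_k)` and `|φ_k'(δ)| = O(k √h_k)` locally uniformly in `(-1, 1)`.
Hence `∑ h_k⁻¹ |φ_k(δ)| ^ p` converges for `p > 2 + 2 / N`, and interpolating the two bounds makes
`|φ_k(0) - φ_k(δ)|` smaller by the factor `|δ| ^ α` at the price of a factor `k ^ α`, which is still
summable for small `α`.
-/

namespace SphereMean

section Gegenbauer

open Polynomial

/-- The Gegenbauer polynomials of index `N / 2`, normalized to take the value `1` at `1`. They
parametrize the zonal spherical harmonics on the unit sphere of `ℝ ^ (N + 2)`. -/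
noncomputable def gegenbauer (N : ℕ) : ℕ → ℝ[X]
  | 0 => 1
  | 1 => X
  | k + 2 => C ((k + 1 + N : ℝ)⁻¹) *
      (C (2 * k + 2 + N : ℝ) * X * gegenbauer N (k + 1) - C (k + 1 : ℝ) * gegenbauer N k)

theorem map_C_mul (l : ℝ[X] →ₗ[ℝ] ℝ) (r : ℝ) (p : ℝ[X]) : l (C r * p) = r * l p := by
  rw [← smul_eq_C_mul, map_smul, smul_eq_mul]

theorem one_sub_X_sq_ne_zero : (1 - X ^ 2 : ℝ[X]) ≠ 0 := by
  intro h
  simpa using congrArg (eval 0) h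

variable (N : ℕ)

@[simp] theorem gegenbauer_zero : gegenbauer N 0 = 1 := by rw [gegenbauer]

@[simp] theorem gegenbauer_one : gegenbauer N 1 = X := by rw [gegenbauer]

theorem gegenbauer_recurrence (k : ℕ) :
    (k + 1 + N : ℝ[X]) * gegenbauer N (k + 2) =
      (2 * k + 2 + N : ℝ[X]) * X * gegenbauer N (k + 1) - (k + 1 : ℝ[X]) * gegenbauer N k := by
  have h : (k + 1 + N : ℝ[X]) * C ((k + 1 + N : ℝ)⁻¹) = 1 := by
    have h0 : (k + 1 + N : ℝ) ≠ 0 := by positivity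
    rw [show (k + 1 + N : ℝ[X]) = C (k + 1 + N : ℝ) by simp, ← C_mul, mul_inv_cancel₀ h0, C_1]
  rw [gegenbauer, ← mul_assoc, h, one_mul]
  simp only [C_add, C_mul, map_natCast, C_1, C_ofNat]

theorem eval_gegenbauer_recurrence (k : ℕ) (t : ℝ) :
    (k + 1 + N : ℝ) * (gegenbauer N (k + 2)).eval t =
      (2 * k + 2 + N) * t * (gegenbauer N (k + 1)).eval t -
        (k + 1) * (gegenbauer N k).eval t := by
  simpa using congrArg (eval t) (gegenbauer_recurrence N k)

theorem gegenbauer_eval_one (k : ℕ) : (gegenbauer N k).eval 1 = 1 := by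
  induction k using Nat.twoStepInduction with
  | zero => simp
  | one => simp
  | more k h0 h1 =>
    have h := eval_gegenbauer_recurrence N k 1
    rw [h0, h1] at h
    exact mul_left_cancel₀ (show (k + 1 + N : ℝ) ≠ 0 by positivity) (by linarith)

theorem derivative_gegenbauer_and_succ (k : ℕ) :
    (1 - X ^ 2) * derivative (gegenbauer N k) =
      (k + N : ℝ[X]) * (X * gegenbauer N k - gegenbauer N (k + 1)) ∧
    (1 - X ^ 2) * derivative (gegenbauer N (k + 1)) =
      (k + 1 : ℝ[X]) * (gegenbauer N k - X * gegenbauer N (k + 1)) := by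
  induction k with
  | zero =>
    simp only [gegenbauer_zero, zero_add, gegenbauer_one, derivative_one, derivative_X,
      CharP.cast_eq_zero]
    constructor <;> ring
  | succ k ih =>
    obtain ⟨h0, h1⟩ := ih
    have r := gegenbauer_recurrence N k
    have r' := congrArg derivative r
    simp only [derivative_mul, derivative_sub, derivative_add, derivative_natCast, derivative_X,
      derivative_one, derivative_ofNat] at r'
    push_cast
    constructor
    · linear_combination h1 + r
    · have h : ((k + 1 + N : ℕ) : ℝ[X]) ≠ 0 := Nat.cast_ne_zero.2 (by omega)
      push_cast at h
      refine mul_left_cancel₀ h ?_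
      linear_combination (1 - X ^ 2) * r' - (k + 1) * h0 + (2 * k + 2 + N) * X * h1
        + (k + 2) * X * r

theorem derivative_gegenbauer (k : ℕ) :
    (1 - X ^ 2) * derivative (gegenbauer N k) =
      (k + N : ℝ[X]) * (X * gegenbauer N k - gegenbauer N (k + 1)) :=
  (derivative_gegenbauer_and_succ N k).1

theorem derivative_gegenbauer_succ (k : ℕ) :
    (1 - X ^ 2) * derivative (gegenbauer N (k + 1)) =
      (k + 1 : ℝ[X]) * (gegenbauer N k - X * gegenbauer N (k + 1)) :=
  (derivative_gegenbauer_and_succ N k).2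

theorem derivative_gegenbauer_sub (k : ℕ) :
    (k + 1 + N : ℝ[X]) * (k + N) * derivative (gegenbauer N (k + 2)) -
      (k + 2) * (k + 1) * derivative (gegenbauer N k) =
      (2 * k + 2 + N) * (k + 2) * (k + N) * gegenbauer N (k + 1) := by
  refine mul_left_cancel₀ one_sub_X_sq_ne_zero ?_
  have h1 := derivative_gegenbauer_succ N (k + 1)
  push_cast at h1
  linear_combination (k + 1 + N : ℝ[X]) * (k + N) * h1
    - (k + 2) * (k + 1) * derivative_gegenbauer N k
    - (k + 2) * (k + N) * X * gegenbauer_recurrence N k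

theorem gegenbauer_ode (k : ℕ) :
    (1 - X ^ 2) * derivative (derivative (gegenbauer N k)) =
      (N + 1 : ℝ[X]) * X * derivative (gegenbauer N k) -
        (k * (k + N) : ℝ[X]) * gegenbauer N k := by
  have h := congrArg derivative (derivative_gegenbauer N k)
  simp only [derivative_mul, derivative_sub, derivative_add, derivative_natCast, derivative_X,
    derivative_one, derivative_X_sq, C_ofNat] at h
  refine mul_left_cancel₀ one_sub_X_sq_ne_zero ?_
  linear_combination (1 - X ^ 2) * h + (k + 1) * X * derivative_gegenbauer N k
    - (k + N) * derivative_gegenbauer_succ N k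

variable {N}

theorem map_gegenbauer_recurrence (l : ℝ[X] →ₗ[ℝ] ℝ) (k : ℕ) :
    (k + 1 + N : ℝ) * l (gegenbauer N (k + 2)) =
      (2 * k + 2 + N) * l (X * gegenbauer N (k + 1)) - (k + 1) * l (gegenbauer N k) := by
  simp only [← map_C_mul, ← map_sub]
  congr 1
  simp only [C_add, C_mul, map_natCast, C_1, C_ofNat]
  linear_combination gegenbauer_recurrence N k

theorem map_derivative_gegenbauer_recurrence (l : ℝ[X] →ₗ[ℝ] ℝ) (q : ℝ[X]) (k : ℕ) :
    (k + 1 + N : ℝ) * (k + N) * l (q * derivative (gegenbauer N (k + 2))) =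
      (2 * k + 2 + N) * (k + 2) * (k + N) * l (q * gegenbauer N (k + 1)) +
        (k + 2) * (k + 1) * l (q * derivative (gegenbauer N k)) := by
  simp only [← map_C_mul, ← map_add]
  congr 1
  simp only [C_add, C_mul, map_natCast, C_1, C_ofNat]
  linear_combination q * derivative_gegenbauer_sub N k

/-- The integration by parts identity satisfied by `p ↦ ∫ p (a c + √(1 - a²) √(1 - c²) u)`, where
`u` is a coordinate of a uniform point on the unit sphere of `ℝ ^ (N + 1)`; the product formula for
Gegenbauer polynomials is a formal consequence of it. -/
structure IsProductFunctional (N : ℕ) (a c : ℝ) (l : ℝ[X] →ₗ[ℝ] ℝ) : Prop where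
  map_one : l 1 = 1
  by_parts (p : ℝ[X]) : l ((C (1 - a ^ 2 - c ^ 2) - X ^ 2 + C (2 * a * c) * X) * derivative p) =
    l (C (N : ℝ) * (X - C (a * c)) * p)

namespace IsProductFunctional

variable {a c : ℝ} {l : ℝ[X] →ₗ[ℝ] ℝ}

theorem map_X (hl : IsProductFunctional N a c l) (hN : N ≠ 0) : l X = a * c := by
  have h := hl.by_parts 1
  rw [derivative_one, mul_zero, map_zero, mul_one, map_C_mul, map_sub, ← mul_one (C (a * c)),
    map_C_mul, hl.map_one, mul_one] at h
  have hN' : (N : ℝ) ≠ 0 := Nat.cast_ne_zero.2 hN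
  exact sub_eq_zero.1 ((mul_eq_zero.1 h.symm).resolve_left hN')

theorem map_gegenbauer_succ (hl : IsProductFunctional N a c l) (k : ℕ) :
    (k + N : ℝ) * l (gegenbauer N (k + 1)) =
      k * l (X * gegenbauer N k) + N * (a * c) * l (gegenbauer N k) -
        a * l ((C a - C c * X) * derivative (gegenbauer N k)) -
        c * l ((C c - C a * X) * derivative (gegenbauer N k)) := by
  rw [← sub_eq_zero, ← sub_eq_zero.2 (hl.by_parts (gegenbauer N k)).symm]
  simp only [← map_C_mul, ← map_add, ← map_sub]
  congr 1
  simp only [C_add, C_sub, C_mul, C_pow, map_natCast, C_1, C_ofNat]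
  linear_combination derivative_gegenbauer N k

variable {k : ℕ}

theorem map_gegenbauer_step (hl : IsProductFunctional N a c l)
    (h0 : l (gegenbauer N k) = (gegenbauer N k).eval a * (gegenbauer N k).eval c)
    (h1 : l (gegenbauer N (k + 1)) = (gegenbauer N (k + 1)).eval a * (gegenbauer N (k + 1)).eval c)
    (ha : l ((C a - C c * X) * derivative (gegenbauer N (k + 1))) =
      (k + 1 + N) * (gegenbauer N (k + 1)).eval a *
        (c * (gegenbauer N (k + 1)).eval c - (gegenbauer N (k + 2)).eval c))
    (hc : l ((C c - C a * X) * derivative (gegenbauer N (k + 1))) =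
      (k + 1 + N) * (gegenbauer N (k + 1)).eval c *
        (a * (gegenbauer N (k + 1)).eval a - (gegenbauer N (k + 2)).eval a)) :
    l (gegenbauer N (k + 2)) =
      (gegenbauer N (k + 2)).eval a * (gegenbauer N (k + 2)).eval c := by
  have hs := hl.map_gegenbauer_succ (k + 1)
  have hr := map_gegenbauer_recurrence (N := N) l k
  have ra := eval_gegenbauer_recurrence N k a
  have rc := eval_gegenbauer_recurrence N k c
  push_cast at hs
  rw [h1, ha, hc] at hs
  rw [h0] at hr
  refine mul_left_cancel₀ (show (k + 1 + N : ℝ) ^ 2 ≠ 0 by positivity) ?_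
  linear_combination (2 * k + 2 + N) * hs - (k + 1) * hr +
    ((2 * k + 2 + N) * c * (gegenbauer N (k + 1)).eval c -
      (k + 1 + N) * (gegenbauer N (k + 2)).eval c) * ra +
    (k + 1) * (gegenbauer N k).eval a * rc

theorem map_derivative_gegenbauer_step (l : ℝ[X] →ₗ[ℝ] ℝ) (hN : N ≠ 0)
    (h0 : l (gegenbauer N k) = (gegenbauer N k).eval a * (gegenbauer N k).eval c)
    (h1 : l (gegenbauer N (k + 1)) = (gegenbauer N (k + 1)).eval a * (gegenbauer N (k + 1)).eval c)
    (h2 : l (gegenbauer N (k + 2)) = (gegenbauer N (k + 2)).eval a * (gegenbauer N (k + 2)).eval c)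
    (ha : l ((C a - C c * X) * derivative (gegenbauer N k)) =
      (k + N) * (gegenbauer N k).eval a *
        (c * (gegenbauer N k).eval c - (gegenbauer N (k + 1)).eval c)) :
    l ((C a - C c * X) * derivative (gegenbauer N (k + 2))) =
      (k + 2 + N) * (gegenbauer N (k + 2)).eval a *
        (c * (gegenbauer N (k + 2)).eval c - (gegenbauer N (k + 3)).eval c) := by
  have hd := map_derivative_gegenbauer_recurrence (N := N) l (C a - C c * X) k
  have hr := map_gegenbauer_recurrence (N := N) l k
  have ra := eval_gegenbauer_recurrence N k a
  have rc := eval_gegenbauer_recurrence N (k + 1) c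
  have hm : l ((C a - C c * X) * gegenbauer N (k + 1)) =
      a * l (gegenbauer N (k + 1)) - c * l (X * gegenbauer N (k + 1)) := by
    rw [sub_mul, mul_assoc, map_sub, map_C_mul, map_C_mul]
  have hN' : (0 : ℝ) < N := by exact_mod_cast Nat.pos_of_ne_zero hN
  push_cast at rc
  rw [ha, hm, h1] at hd
  rw [h0, h2] at hr
  refine mul_left_cancel₀ (show (k + 1 + N : ℝ) * (k + N) ≠ 0 by positivity) ?_
  linear_combination hd + c * (k + 2) * (k + N) * hr -
    (k + 2) * (k + N) * (gegenbauer N (k + 1)).eval c * ra +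
    (k + 1 + N) * (k + N) * (gegenbauer N (k + 2)).eval a * rc

/-- By `derivative_gegenbauer`, the second identity is the derivative in `c` of the first one, the
product formula. The induction needs all three. -/
theorem map_gegenbauer_and_derivative (hl : IsProductFunctional N a c l) (hN : N ≠ 0) (k : ℕ) :
    l (gegenbauer N k) = (gegenbauer N k).eval a * (gegenbauer N k).eval c ∧
    l ((C a - C c * X) * derivative (gegenbauer N k)) =
      (k + N) * (gegenbauer N k).eval a *
        (c * (gegenbauer N k).eval c - (gegenbauer N (k + 1)).eval c) ∧
    l ((C c - C a * X) * derivative (gegenbauer N k)) =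
      (k + N) * (gegenbauer N k).eval c *
        (a * (gegenbauer N k).eval a - (gegenbauer N (k + 1)).eval a) := by
  induction k using Nat.twoStepInduction with
  | zero => simp [hl.map_one]
  | one =>
    have hlin (b d : ℝ) : l ((C b - C d * X) * derivative X) = b - d * (a * c) := by
      rw [derivative_X, mul_one, map_sub, map_C_mul, hl.map_X hN, ← mul_one (C b),
        map_C_mul, hl.map_one, mul_one]
    have hrec (t : ℝ) : (1 + N : ℝ) * (gegenbauer N 2).eval t = (2 + N) * t * t - 1 := by
      simpa using eval_gegenbauer_recurrence N 0 t
    simp only [hlin, gegenbauer_one, eval_X, Nat.cast_one, Nat.reduceAdd]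
    exact ⟨hl.map_X hN, by linear_combination a * hrec c, by linear_combination c * hrec a⟩
  | more k ih0 ih1 =>
    obtain ⟨h0, ha0, hc0⟩ := ih0
    obtain ⟨h1, ha1, hc1⟩ := ih1
    push_cast at ha1 hc1 ⊢
    have h2 := hl.map_gegenbauer_step h0 h1 ha1 hc1
    refine ⟨h2, map_derivative_gegenbauer_step l hN h0 h1 h2 ha0,
      map_derivative_gegenbauer_step l hN ?_ ?_ ?_ hc0⟩
    · rw [h0, mul_comm]
    · rw [h1, mul_comm]
    · rw [h2, mul_comm]

end IsProductFunctional
end Gegenbauer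

section GegenbauerFunctional

open Polynomial

/-- The squared norm of `gegenbauer N k` in `L²` of the unit sphere of `ℝ ^ (N + 2)` with its
probability measure, for `N ≠ 0`; see `IsGegenbauerFunctional.map_gegenbauer_sq`. -/
noncomputable def gegenbauerNormSq (N k : ℕ) : ℝ :=
  N.factorial / ((2 * k + N) * (k + 1).ascFactorial (N - 1))

/-- The properties used of the functional `p ↦ ∫ p ⟪x, e⟫`, where `x` is uniform on the unit sphere
of `ℝ ^ (N + 2)` and `e` is a unit vector. -/
structure IsGegenbauerFunctional (N : ℕ) (I : ℝ[X] →ₗ[ℝ] ℝ) : Prop where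
  map_one : I 1 = 1
  by_parts (p : ℝ[X]) : I ((1 - X ^ 2) * derivative p) = I (C (N + 1 : ℝ) * (X * p))
  nonneg (p : ℝ[X]) : (∀ t ∈ Icc (-1 : ℝ) 1, 0 ≤ p.eval t) → 0 ≤ I p

variable {N : ℕ}

theorem gegenbauerNormSq_pos (hN : N ≠ 0) (k : ℕ) : 0 < gegenbauerNormSq N k := by
  have : (0 : ℝ) < N := by exact_mod_cast Nat.pos_of_ne_zero hN
  have := Nat.ascFactorial_pos k (N - 1)
  unfold gegenbauerNormSq
  positivity

theorem gegenbauerNormSq_zero (hN : N ≠ 0) : gegenbauerNormSq N 0 = 1 := by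
  have h := Nat.mul_factorial_pred hN
  have h0 : (N.factorial : ℝ) ≠ 0 := by exact_mod_cast N.factorial_ne_zero
  rw [gegenbauerNormSq, zero_add, Nat.one_ascFactorial, Nat.cast_zero, mul_zero, zero_add,
    ← Nat.cast_mul, h, div_self h0]

theorem gegenbauerNormSq_recurrence (hN : N ≠ 0) (k : ℕ) :
    (k + N : ℝ) * (2 * k + 2 + N) * gegenbauerNormSq N (k + 1) =
      (2 * k + N) * (k + 1) * gegenbauerNormSq N k := by
  obtain ⟨M, rfl⟩ := Nat.exists_eq_succ_of_ne_zero hN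
  have h : ((k + 1 : ℕ) : ℝ) * ((k + 1 + 1).ascFactorial M : ℕ) =
      ((k + 1 + M : ℕ) : ℝ) * ((k + 1).ascFactorial M : ℕ) := by
    exact_mod_cast Nat.succ_ascFactorial (k + 1) M
  have h0 : ((k + 1).ascFactorial M : ℝ) ≠ 0 := by
    exact_mod_cast (Nat.ascFactorial_pos k M).ne'
  have h1 : ((k + 1 + 1).ascFactorial M : ℝ) ≠ 0 := by
    exact_mod_cast (Nat.ascFactorial_pos (k + 1) M).ne'
  have h2 : (2 * (k + 1) + (M + 1) : ℝ) ≠ 0 := by positivity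
  simp only [gegenbauerNormSq, Nat.succ_eq_add_one, Nat.add_sub_cancel]
  push_cast at h ⊢
  field_simp
  linear_combination -h

theorem gegenbauerNormSq_le (hN : N ≠ 0) (k : ℕ) :
    gegenbauerNormSq N k ≤ N.factorial / (k + 1 : ℝ) ^ N := by
  have h1 : (k + 1 : ℝ) ^ (N - 1) ≤ ((k + 1).ascFactorial (N - 1) : ℕ) := by
    exact_mod_cast Nat.pow_succ_le_ascFactorial (k + 1) (N - 1)
  have h2 : (k + 1 : ℝ) ≤ 2 * k + N := by
    have hN' : (1 : ℝ) ≤ N := by exact_mod_cast Nat.pos_of_ne_zero hN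
    linarith [k.cast_nonneg (α := ℝ)]
  rw [gegenbauerNormSq, ← mul_pow_sub_one hN]
  gcongr

namespace IsGegenbauerFunctional

variable {I : ℝ[X] →ₗ[ℝ] ℝ}

theorem dirichlet (hI : IsGegenbauerFunctional N I) (k : ℕ) (q : ℝ[X]) :
    I ((1 - X ^ 2) * (derivative (gegenbauer N k) * derivative q)) =
      k * (k + N) * I (gegenbauer N k * q) := by
  have h := hI.by_parts (derivative (gegenbauer N k) * q)
  rw [← map_C_mul, ← sub_eq_zero, ← map_sub]
  rw [← sub_eq_zero, ← map_sub] at h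
  convert h using 2
  simp only [C_add, C_mul, map_natCast, C_1, derivative_mul]
  linear_combination -q * gegenbauer_ode N k

theorem orthogonal (hI : IsGegenbauerFunctional N I) {j k : ℕ} (hjk : j ≠ k) :
    I (gegenbauer N j * gegenbauer N k) = 0 := by
  have hj := hI.dirichlet j (gegenbauer N k)
  have hk := hI.dirichlet k (gegenbauer N j)
  rw [mul_comm (derivative (gegenbauer N k)), mul_comm (gegenbauer N k), hj] at hk
  have h : ((j : ℝ) - k) * (j + k + N) * I (gegenbauer N j * gegenbauer N k) = 0 := by
    linear_combination hk
  have h1 : (j : ℝ) - k ≠ 0 := sub_ne_zero.2 (by exact_mod_cast hjk)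
  have h2 : (j + k + N : ℝ) ≠ 0 := by
    have : j + k + N ≠ 0 := by omega
    exact_mod_cast this
  simpa [h1, h2] using h

theorem map_mul_gegenbauer_recurrence (l : ℝ[X] →ₗ[ℝ] ℝ) (q : ℝ[X]) (k : ℕ) :
    (k + 1 + N : ℝ) * l (gegenbauer N (k + 2) * q) =
      (2 * k + 2 + N) * l (X * gegenbauer N (k + 1) * q) - (k + 1) * l (gegenbauer N k * q) := by
  simp only [← map_C_mul, ← map_sub]
  congr 1
  simp only [C_add, C_mul, map_natCast, C_1, C_ofNat]
  linear_combination q * gegenbauer_recurrence N k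

theorem sq_recurrence (hI : IsGegenbauerFunctional N I) (k : ℕ) :
    (k + N : ℝ) * (2 * k + 2 + N) * I (gegenbauer N (k + 1) * gegenbauer N (k + 1)) =
      (2 * k + N) * (k + 1) * I (gegenbauer N k * gegenbauer N k) := by
  have h1 : (2 * k + 2 + N : ℝ) * I (X * gegenbauer N (k + 1) * gegenbauer N k) =
      (k + 1) * I (gegenbauer N k * gegenbauer N k) := by
    have h := map_mul_gegenbauer_recurrence (N := N) I (gegenbauer N k) k
    rw [hI.orthogonal (show k + 2 ≠ k by omega)] at h
    linear_combination -h
  have h2 : (2 * k + N : ℝ) * I (X * gegenbauer N (k + 1) * gegenbauer N k) =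
      (k + N) * I (gegenbauer N (k + 1) * gegenbauer N (k + 1)) := by
    rcases k with _ | k
    · simp
    · have h := map_mul_gegenbauer_recurrence (N := N) I (gegenbauer N (k + 2)) k
      rw [hI.orthogonal (show k ≠ k + 2 by omega), mul_right_comm] at h
      push_cast
      linear_combination -h
  linear_combination -(2 * k + 2 + N : ℝ) * h2 + (2 * k + N : ℝ) * h1

theorem map_gegenbauer_sq (hI : IsGegenbauerFunctional N I) (hN : N ≠ 0) (k : ℕ) :
    I (gegenbauer N k * gegenbauer N k) = gegenbauerNormSq N k := by
  induction k with
  | zero => rw [gegenbauer_zero, mul_one, hI.map_one, gegenbauerNormSq_zero hN]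
  | succ k ih =>
    have h := hI.sq_recurrence k
    have hN' : (0 : ℝ) < N := by exact_mod_cast Nat.pos_of_ne_zero hN
    rw [ih, ← gegenbauerNormSq_recurrence hN] at h
    exact mul_left_cancel₀ (by positivity) h

end IsGegenbauerFunctional

/-- The energy of the Gegenbauer differential equation. -/
noncomputable def gegenbauerEnergy (N k : ℕ) : ℝ[X] :=
  C (k * (k + N) : ℝ) * (gegenbauer N k * gegenbauer N k) +
    (1 - X ^ 2) * (derivative (gegenbauer N k) * derivative (gegenbauer N k))

theorem eval_gegenbauerEnergy (N k : ℕ) (t : ℝ) : (gegenbauerEnergy N k).eval t =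
    k * (k + N) * (gegenbauer N k).eval t ^ 2 +
      (1 - t ^ 2) * (derivative (gegenbauer N k)).eval t ^ 2 := by
  simp only [gegenbauerEnergy, eval_add, eval_mul, eval_C, eval_sub, eval_one, eval_pow, eval_X]
  ring

theorem derivative_gegenbauerEnergy (N k : ℕ) :
    derivative (gegenbauerEnergy N k) = C (2 * N : ℝ) * X * derivative (gegenbauer N k) ^ 2 := by
  simp only [gegenbauerEnergy, derivative_add, derivative_mul, derivative_sub, derivative_one,
    derivative_X_sq, derivative_natCast, C_ofNat, C_mul, C_add, map_natCast]
  linear_combination 2 * derivative (gegenbauer N k) * gegenbauer_ode N k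

theorem derivative_weighted_gegenbauerEnergy (N k : ℕ) :
    derivative ((1 - X ^ 2) ^ N * gegenbauerEnergy N k) =
      -((1 - X ^ 2) ^ (N - 1) * C (2 * N * (k * (k + N)) : ℝ) * X * gegenbauer N k ^ 2) := by
  rcases N with _ | M
  · simp [derivative_gegenbauerEnergy]
  rw [derivative_mul, derivative_gegenbauerEnergy, derivative_pow_succ, gegenbauerEnergy]
  simp only [derivative_sub, derivative_one, derivative_X_sq, C_ofNat, C_mul, C_add,
    map_natCast, C_1, Nat.cast_add, Nat.cast_one, Nat.add_sub_cancel]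
  ring

theorem eval_zero_le_eval {p : ℝ[X]} (hp : ∀ t ∈ Icc (-1 : ℝ) 1, 0 ≤ t * (derivative p).eval t)
    {t : ℝ} (ht : t ∈ Icc (-1 : ℝ) 1) : p.eval 0 ≤ p.eval t := by
  have hmono : MonotoneOn (fun s => (p.comp (C t * X)).eval s) (Icc 0 1) := by
    refine monotoneOn_of_deriv_nonneg (convex_Icc 0 1) (by fun_prop) (by fun_prop) fun s hs => ?_
    rw [interior_Icc] at hs
    have hts : t * s ∈ Icc (-1 : ℝ) 1 := by
      constructor <;> nlinarith [ht.1, ht.2, hs.1, hs.2]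
    have h := hp (t * s) hts
    rw [mul_right_comm] at h
    rw [Polynomial.deriv]
    simpa [derivative_comp] using nonneg_of_mul_nonneg_left h hs.1
  simpa using hmono (left_mem_Icc.2 zero_le_one) (right_mem_Icc.2 zero_le_one) zero_le_one

theorem gegenbauerEnergy_zero_le (N k : ℕ) {t : ℝ} (ht : t ∈ Icc (-1 : ℝ) 1) :
    (gegenbauerEnergy N k).eval 0 ≤ (gegenbauerEnergy N k).eval t := by
  refine eval_zero_le_eval (fun s _ => ?_) ht
  have h : s * (derivative (gegenbauerEnergy N k)).eval s =
      2 * N * (s * (derivative (gegenbauer N k)).eval s) ^ 2 := by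
    rw [derivative_gegenbauerEnergy]
    simp only [eval_mul, eval_C, eval_X, eval_pow]
    ring
  rw [h]
  positivity

theorem one_sub_sq_nonneg {t : ℝ} (ht : t ∈ Icc (-1 : ℝ) 1) : 0 ≤ 1 - t ^ 2 := by
  nlinarith [ht.1, ht.2]

theorem weighted_gegenbauerEnergy_le_zero (N k : ℕ) {t : ℝ} (ht : t ∈ Icc (-1 : ℝ) 1) :
    (1 - t ^ 2) ^ N * (gegenbauerEnergy N k).eval t ≤ (gegenbauerEnergy N k).eval 0 := by
  have h := eval_zero_le_eval (p := -((1 - X ^ 2) ^ N * gegenbauerEnergy N k)) (fun s hs => ?_) ht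
  · simpa using h
  have h : s * (derivative (-((1 - X ^ 2) ^ N * gegenbauerEnergy N k))).eval s =
      2 * N * (k * (k + N)) * (1 - s ^ 2) ^ (N - 1) * (s * (gegenbauer N k).eval s) ^ 2 := by
    rw [derivative_neg, derivative_weighted_gegenbauerEnergy, neg_neg]
    simp only [eval_mul, eval_C, eval_X, eval_pow, eval_sub, eval_one]
    ring
  rw [h]
  have := one_sub_sq_nonneg hs
  positivity

namespace IsGegenbauerFunctional

variable {I : ℝ[X] →ₗ[ℝ] ℝ}

theorem weighted_gegenbauerEnergy_le (hI : IsGegenbauerFunctional N I) (hN : N ≠ 0) (k : ℕ)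
    {t : ℝ} (ht : t ∈ Icc (-1 : ℝ) 1) :
    (1 - t ^ 2) ^ N * (gegenbauerEnergy N k).eval t ≤
      2 * (k * (k + N)) * gegenbauerNormSq N k := by
  refine (weighted_gegenbauerEnergy_le_zero N k ht).trans ?_
  have h := hI.nonneg (gegenbauerEnergy N k - C ((gegenbauerEnergy N k).eval 0) * 1)
    fun t ht => by simpa using gegenbauerEnergy_zero_le N k ht
  have hE : I (gegenbauerEnergy N k) = 2 * (k * (k + N)) * gegenbauerNormSq N k := by
    rw [gegenbauerEnergy, map_add, map_C_mul, hI.dirichlet, hI.map_gegenbauer_sq hN]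
    ring
  rw [map_sub, map_C_mul, hI.map_one, hE] at h
  linarith

theorem eval_sq_le (hI : IsGegenbauerFunctional N I) (hN : N ≠ 0) (k : ℕ) {t : ℝ}
    (ht : t ∈ Icc (-1 : ℝ) 1) :
    (1 - t ^ 2) ^ N * (gegenbauer N k).eval t ^ 2 ≤ 2 * gegenbauerNormSq N k := by
  have hw := one_sub_sq_nonneg ht
  rcases k.eq_zero_or_pos with rfl | hk
  · rw [gegenbauer_zero, eval_one, one_pow, mul_one, gegenbauerNormSq_zero hN]
    exact (pow_le_one₀ hw (by nlinarith)).trans (by norm_num)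
  have h := hI.weighted_gegenbauerEnergy_le hN k ht
  rw [eval_gegenbauerEnergy] at h
  have hK : (0 : ℝ) < k * (k + N) := by positivity
  have : 0 ≤ (1 - t ^ 2) ^ N * ((1 - t ^ 2) * (derivative (gegenbauer N k)).eval t ^ 2) := by
    positivity
  refine le_of_mul_le_mul_left ?_ hK
  linarith

theorem eval_derivative_sq_le (hI : IsGegenbauerFunctional N I) (hN : N ≠ 0) (k : ℕ) {t : ℝ}
    (ht : t ∈ Icc (-1 : ℝ) 1) :
    (1 - t ^ 2) ^ (N + 1) * (derivative (gegenbauer N k)).eval t ^ 2 ≤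
      2 * (k * (k + N)) * gegenbauerNormSq N k := by
  have hw := one_sub_sq_nonneg ht
  have h := hI.weighted_gegenbauerEnergy_le hN k ht
  rw [eval_gegenbauerEnergy] at h
  have : 0 ≤ (1 - t ^ 2) ^ N * (k * (k + N) * (gegenbauer N k).eval t ^ 2) := by positivity
  rw [pow_succ]
  linarith

theorem abs_eval_le (hI : IsGegenbauerFunctional N I) (hN : N ≠ 0) (k : ℕ) {t : ℝ}
    (ht : |t| < 1) :
    |(gegenbauer N k).eval t| ≤ √(2 * (N + 1) / (1 - t ^ 2) ^ (N + 1) * gegenbauerNormSq N k) := by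
  have hw : 0 < 1 - t ^ 2 := sub_pos.2 ((sq_lt_one_iff_abs_lt_one t).2 ht)
  have h := hI.eval_sq_le hN k (abs_le.1 ht.le)
  refine Real.abs_le_sqrt ?_
  rw [div_mul_eq_mul_div, le_div_iff₀ (by positivity), mul_comm]
  calc (1 - t ^ 2) ^ (N + 1) * (gegenbauer N k).eval t ^ 2
      ≤ (1 - t ^ 2) ^ N * (gegenbauer N k).eval t ^ 2 := by
        gcongr ?_ * _
        exact pow_le_pow_of_le_one hw.le (by nlinarith) N.le_succ
    _ ≤ 2 * gegenbauerNormSq N k := h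
    _ ≤ 2 * (N + 1) * gegenbauerNormSq N k := by
        have := gegenbauerNormSq_pos hN k
        nlinarith [N.cast_nonneg (α := ℝ)]

theorem abs_eval_derivative_le (hI : IsGegenbauerFunctional N I) (hN : N ≠ 0) (k : ℕ) {t : ℝ}
    (ht : |t| < 1) :
    |(derivative (gegenbauer N k)).eval t| ≤
      (k + 1) * √(2 * (N + 1) / (1 - t ^ 2) ^ (N + 1) * gegenbauerNormSq N k) := by
  have hw : 0 < 1 - t ^ 2 := sub_pos.2 ((sq_lt_one_iff_abs_lt_one t).2 ht)
  have h := hI.eval_derivative_sq_le hN k (abs_le.1 ht.le)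
  have hk : (0 : ℝ) ≤ k + 1 := by positivity
  rw [← Real.sqrt_sq hk, ← Real.sqrt_mul (sq_nonneg _)]
  refine Real.abs_le_sqrt ?_
  rw [div_mul_eq_mul_div, ← mul_div_assoc, le_div_iff₀ (by positivity), mul_comm]
  refine h.trans ?_
  have hkN : (k * (k + N) : ℝ) ≤ (k + 1) ^ 2 * (N + 1) := by
    have : (0 : ℝ) ≤ k ^ 2 * N + k * N + 2 * k + N + 1 := by positivity
    linarith
  have := gegenbauerNormSq_pos hN k
  calc 2 * (k * (k + N)) * gegenbauerNormSq N k
      ≤ 2 * ((k + 1) ^ 2 * (N + 1)) * gegenbauerNormSq N k := by gcongr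
    _ = (k + 1) ^ 2 * (2 * (N + 1) * gegenbauerNormSq N k) := by ring

end IsGegenbauerFunctional

theorem le_two_mul_rpow {x y P α : ℝ} (hx : 0 ≤ x) (hP : 0 ≤ P) (hα : 0 ≤ α) (hα1 : α ≤ 1)
    (h2 : y ≤ 2 * P) (hxP : y ≤ x * P) : y ≤ 2 * P * x ^ α := by
  rcases le_total 1 x with h1 | h1
  · exact h2.trans (le_mul_of_one_le_right (by positivity) (Real.one_le_rpow h1 hα))
  · have hxα : x ≤ x ^ α := by
      simpa using Real.rpow_le_rpow_of_exponent_ge' hx h1 hα hα1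
    nlinarith [mul_le_mul_of_nonneg_left hxα hP, Real.rpow_nonneg hx α]

namespace IsGegenbauerFunctional

variable {I : ℝ[X] →ₗ[ℝ] ℝ}

theorem abs_eval_sub_le (hI : IsGegenbauerFunctional N I) (hN : N ≠ 0) (k : ℕ) {t : ℝ}
    (ht : |t| ≤ 1 / 2) {α : ℝ} (hα : 0 ≤ α) (hα1 : α ≤ 1) :
    |(gegenbauer N k).eval 0 - (gegenbauer N k).eval t| ≤
      2 * √((N + 1) * 2 ^ (N + 2)) * |t| ^ α * (√(gegenbauerNormSq N k) * (k + 1) ^ α) := by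
  set P : ℝ := √((N + 1) * 2 ^ (N + 2) * gegenbauerNormSq N k) with hPdef
  have hlt {s : ℝ} (hs : |s| ≤ 1 / 2) : |s| < 1 := by linarith
  have hP {s : ℝ} (hs : |s| ≤ 1 / 2) :
      √(2 * (N + 1) / (1 - s ^ 2) ^ (N + 1) * gegenbauerNormSq N k) ≤ P := by
    have := gegenbauerNormSq_pos hN k
    have hw : 1 / 2 ≤ 1 - s ^ 2 := by nlinarith [abs_le.1 hs]
    refine Real.sqrt_le_sqrt (mul_le_mul_of_nonneg_right ?_ this.le)
    calc (2 * (N + 1) / (1 - s ^ 2) ^ (N + 1) : ℝ)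
        ≤ 2 * (N + 1) / (1 / 2) ^ (N + 1) := by gcongr
      _ = (N + 1) * 2 ^ (N + 2) := by rw [one_div, inv_pow, div_inv_eq_mul]; ring
  suffices |(gegenbauer N k).eval 0 - (gegenbauer N k).eval t| ≤ 2 * P * ((k + 1) * |t|) ^ α by
    refine this.trans_eq ?_
    rw [hPdef, Real.sqrt_mul (by positivity), Real.mul_rpow (by positivity) (abs_nonneg _)]
    ring
  refine le_two_mul_rpow (by positivity) (Real.sqrt_nonneg _) hα hα1 ?_ ?_
  · have h0 : |(0 : ℝ)| ≤ 1 / 2 := by norm_num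
    have hφ0 := (hI.abs_eval_le hN k (hlt h0)).trans (hP h0)
    have hφt := (hI.abs_eval_le hN k (hlt ht)).trans (hP ht)
    exact (abs_sub _ _).trans (by linarith)
  · have hmv := (convex_closedBall (0 : ℝ) (1 / 2)).norm_image_sub_le_of_norm_deriv_le
      (f := fun t => (gegenbauer N k).eval t) (C := (k + 1) * P) (x := t) (y := 0)
      (fun x _ => by fun_prop) (fun x hx => ?_) (by simpa using ht) (by simp)
    · simpa [Real.norm_eq_abs, mul_right_comm] using hmv
    · have hx' : |x| ≤ 1 / 2 := by simpa using hx
      rw [Polynomial.deriv]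
      exact (hI.abs_eval_derivative_le hN k (hlt hx')).trans (by gcongr; exact hP hx')

end IsGegenbauerFunctional
end GegenbauerFunctional

section Moments

open Polynomial

theorem hasDerivAt_integral_of_compactSpace {X : Type*} [TopologicalSpace X] [CompactSpace X]
    [MeasurableSpace X] [OpensMeasurableSpace X] {μ : Measure X} [IsFiniteMeasure μ]
    {F F' : ℝ → X → ℝ} (hF : ∀ t, Continuous (F t)) (hF' : Continuous (Function.uncurry F'))
    (hd : ∀ t x, HasDerivAt (F · x) (F' t x) t) (t₀ : ℝ) :
    HasDerivAt (fun t => ∫ x, F t x ∂μ) (∫ x, F' t₀ x ∂μ) t₀ := by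
  have hint {f : X → ℝ} (hf : Continuous f) : Integrable f μ :=
    hf.integrable_of_hasCompactSupport (HasCompactSupport.of_compactSpace f)
  have hK : IsCompact (closedBall t₀ 1 ×ˢ (univ : Set X)) :=
    (isCompact_closedBall t₀ 1).prod isCompact_univ
  obtain ⟨C, hC⟩ := hK.exists_bound_of_continuousOn hF'.continuousOn
  exact (hasDerivAt_integral_of_dominated_loc_of_deriv_le (closedBall_mem_nhds t₀ one_pos)
    (.of_forall fun t => (hint (hF t)).aestronglyMeasurable) (hint (hF t₀))
    (hint (hF'.comp (by fun_prop : Continuous fun x => (t₀, x)))).aestronglyMeasurable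
    (.of_forall fun x t ht => hC (t, x) ⟨ht, mem_univ x⟩) (integrable_const C)
    (.of_forall fun x t _ => hd t x)).2

variable {E : Type*} [NormedAddCommGroup E] [InnerProductSpace ℝ E]

theorem sum_inner_orthonormalBasis_sq {w : E} {ι : Type*} [Fintype ι]
    (b : OrthonormalBasis ι ℝ (ℝ ∙ w)ᗮ) (x : E) :
    ‖w‖ ^ 2 * ∑ i, inner ℝ x (b i : E) ^ 2 = ‖w‖ ^ 2 * ‖x‖ ^ 2 - inner ℝ x w ^ 2 := by
  have hb (i : ι) : inner ℝ x (b i : E) =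
      inner ℝ ((ℝ ∙ w)ᗮ.orthogonalProjectionOnto x) (b i) := by
    rw [Submodule.inner_orthogonalProjectionOnto_eq_of_mem_right]
  have hw : ‖w‖ ^ 2 * ‖(ℝ ∙ w).orthogonalProjectionOnto x‖ ^ 2 = inner ℝ x w ^ 2 := by
    rcases eq_or_ne w 0 with rfl | hw
    · simp
    have hw' : ‖w‖ ≠ 0 := norm_ne_zero_iff.2 hw
    rw [Submodule.coe_norm, Submodule.coe_orthogonalProjectionOnto_apply,
      Submodule.starProjection_singleton, norm_smul, mul_pow, norm_div, div_pow, Real.norm_eq_abs,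
      sq_abs, RCLike.ofReal_real_eq_id, id, norm_pow, norm_norm, real_inner_comm]
    field_simp
  simp only [hb, b.sum_sq_inner_left]
  rw [Submodule.norm_sq_eq_add_norm_sq_projection x (ℝ ∙ w), mul_add, hw]
  ring

variable [FiniteDimensional ℝ E] [MeasurableSpace E] [BorelSpace E]

theorem integral_uniformSphere_reflection {F : Type*} [NormedAddCommGroup F] [NormedSpace ℝ F]
    (g : E → F) (v : E) :
    ∫ x : sphere (0 : E) 1, g ((ℝ ∙ v)ᗮ.reflection x) ∂uniformSphere E =
      ∫ x : sphere (0 : E) 1, g x ∂uniformSphere E := by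
  rw [← sphere_emb.integral_map (g := g),
    ← sphere_emb.integral_map (g := fun x => g ((ℝ ∙ v)ᗮ.reflection x))]
  conv_rhs => rw [← map_uniformSphere_refl v]
  exact ((ℝ ∙ v)ᗮ.reflection.toHomeomorph.measurableEmbedding.integral_map g).symm

theorem integral_inner_mul_eq_zero {u w : E} (huw : inner ℝ u w = 0) (f : ℝ → ℝ) :
    ∫ x : sphere (0 : E) 1, inner ℝ (x : E) u * f (inner ℝ (x : E) w) ∂uniformSphere E = 0 := by
  have hR (x z : E) : inner ℝ ((ℝ ∙ u)ᗮ.reflection x) z =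
      inner ℝ x ((ℝ ∙ u)ᗮ.reflection z) := by
    rw [← LinearIsometryEquiv.inner_map_map (ℝ ∙ u)ᗮ.reflection, Submodule.reflection_reflection]
  have hu : (ℝ ∙ u)ᗮ.reflection u = -u :=
    Submodule.reflection_orthogonalComplement_singleton_eq_neg u
  have hw : (ℝ ∙ u)ᗮ.reflection w = w :=
    Submodule.reflection_mem_subspace_eq_self
      (Submodule.mem_orthogonal_singleton_iff_inner_right.2 huw)
  have h := integral_uniformSphere_reflection (fun x => inner ℝ x u * f (inner ℝ x w)) u
  simp only [hR, hu, hw, inner_neg_right, neg_mul, integral_neg] at h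
  linarith

variable [Nontrivial E]

theorem integrable_of_continuous {F : Type*} [NormedAddCommGroup F]
    {f : sphere (0 : E) 1 → F} (hf : Continuous f) : Integrable f (uniformSphere E) :=
  hf.integrable_of_hasCompactSupport (HasCompactSupport.of_compactSpace f)

theorem integral_inner_sq_mul_deriv {v w : E} (hv : ‖v‖ = 1) (hwv : inner ℝ w v = 0)
    {f f' : ℝ → ℝ} (hf : ∀ t, HasDerivAt f (f' t) t) (hf' : Continuous f') :
    ‖w‖ ^ 2 * ∫ x : sphere (0 : E) 1, inner ℝ (x : E) v ^ 2 * f' (inner ℝ (x : E) w)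
      ∂uniformSphere E =
    ∫ x : sphere (0 : E) 1, inner ℝ (x : E) w * f (inner ℝ (x : E) w) ∂uniformSphere E := by
  have hfc : Continuous f := continuous_iff_continuousAt.2 fun t => (hf t).continuousAt
  -- the integral of `F ε` vanishes since `‖w‖² v - ε w ⟂ w + ε v`; the claim is its `ε`-derivative
  set F : ℝ → sphere (0 : E) 1 → ℝ := fun ε x =>
    inner ℝ (x : E) (‖w‖ ^ 2 • v - ε • w) * f (inner ℝ (x : E) (w + ε • v))
  set F' : ℝ → sphere (0 : E) 1 → ℝ := fun ε x =>
    -inner ℝ (x : E) w * f (inner ℝ (x : E) (w + ε • v)) +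
      inner ℝ (x : E) (‖w‖ ^ 2 • v - ε • w) *
        (f' (inner ℝ (x : E) (w + ε • v)) * inner ℝ (x : E) v)
  have hF0 : (fun ε => ∫ x, F ε x ∂uniformSphere E) = fun _ => 0 := by
    funext ε
    refine integral_inner_mul_eq_zero ?_ f
    simp only [inner_sub_left, inner_add_right, real_inner_smul_left, real_inner_smul_right,
      real_inner_self_eq_norm_sq, hv, hwv, real_inner_comm w v]
    ring
  have hd : HasDerivAt (fun ε => ∫ x, F ε x ∂uniformSphere E) (∫ x, F' 0 x ∂uniformSphere E) 0 := by
    refine hasDerivAt_integral_of_compactSpace (fun ε => by fun_prop) (by fun_prop)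
      (fun ε x => ?_) 0
    have h1 : HasDerivAt (fun ε => inner ℝ (x : E) (‖w‖ ^ 2 • v - ε • w))
        (-inner ℝ (x : E) w) ε := by
      simp only [inner_sub_right, real_inner_smul_right (x : E) w]
      simpa using ((hasDerivAt_id ε).mul_const (inner ℝ (x : E) w)).const_sub
        (inner ℝ (x : E) (‖w‖ ^ 2 • v))
    have h2 : HasDerivAt (fun ε => inner ℝ (x : E) (w + ε • v)) (inner ℝ (x : E) v) ε := by
      simp only [inner_add_right, real_inner_smul_right]
      simpa using ((hasDerivAt_id ε).mul_const (inner ℝ (x : E) v)).const_add (inner ℝ (x : E) w)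
    exact h1.mul ((hf _).comp ε h2)
  rw [hF0] at hd
  have h := hd.unique (hasDerivAt_const 0 0)
  simp only [F', zero_smul, add_zero, sub_zero, real_inner_smul_right] at h
  rw [integral_add (integrable_of_continuous (by fun_prop))
    (integrable_of_continuous (by fun_prop))] at h
  simp only [neg_mul, integral_neg] at h
  rw [← integral_const_mul, ← sub_eq_zero, ← h, neg_add_eq_sub]
  congr! 3
  ring

/-- The law of `⟪x, w⟫`, for `x` uniform on the sphere, as a functional on polynomials. -/
noncomputable def zonalFunctional (w : E) : ℝ[X] →ₗ[ℝ] ℝ where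
  toFun p := ∫ x : sphere (0 : E) 1, p.eval (inner ℝ (x : E) w) ∂uniformSphere E
  map_add' p q := by
    simp only [eval_add]
    exact integral_add (integrable_of_continuous (by fun_prop))
      (integrable_of_continuous (by fun_prop))
  map_smul' r p := by
    simp only [eval_smul, smul_eq_mul, RingHom.id_apply]
    exact integral_const_mul _ _

theorem zonalFunctional_apply (w : E) (p : ℝ[X]) : zonalFunctional w p =
    ∫ x : sphere (0 : E) 1, p.eval (inner ℝ (x : E) w) ∂uniformSphere E := rfl

theorem zonalFunctional_one (w : E) : zonalFunctional w 1 = 1 := by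
  simp [zonalFunctional_apply]

theorem zonalFunctional_by_parts {N : ℕ} (hE : Module.finrank ℝ E = N + 1) (w : E)
    (p : ℝ[X]) : zonalFunctional w ((C (‖w‖ ^ 2) - X ^ 2) * derivative p) =
      zonalFunctional w (C (N : ℝ) * (X * p)) := by
  rcases eq_or_ne w 0 with rfl | hw
  · simp [zonalFunctional_apply]
  set b := stdOrthonormalBasis ℝ (ℝ ∙ w)ᗮ
  have hdim : Module.finrank ℝ (ℝ ∙ w)ᗮ = N := by
    have h := Submodule.finrank_add_finrank_orthogonal (ℝ ∙ w)
    rw [finrank_span_singleton hw] at h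
    omega
  have hb (i) : ‖w‖ ^ 2 * ∫ x : sphere (0 : E) 1, inner ℝ (x : E) (b i : E) ^ 2 *
      (derivative p).eval (inner ℝ (x : E) w) ∂uniformSphere E = zonalFunctional w (X * p) := by
    have hbw := Submodule.mem_orthogonal_singleton_iff_inner_right.1 (b i).2
    have hb1 : ‖(b i : E)‖ = 1 := b.orthonormal.1 i
    rw [integral_inner_sq_mul_deriv hb1 hbw p.hasDerivAt (by fun_prop)]
    simp [zonalFunctional_apply]
  calc zonalFunctional w ((C (‖w‖ ^ 2) - X ^ 2) * derivative p)
      = ∫ x : sphere (0 : E) 1, ∑ i, ‖w‖ ^ 2 * (inner ℝ (x : E) (b i : E) ^ 2 *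
          (derivative p).eval (inner ℝ (x : E) w)) ∂uniformSphere E := by
        rw [zonalFunctional_apply]
        congr with x
        rw [← Finset.mul_sum, ← Finset.sum_mul, ← mul_assoc, sum_inner_orthonormalBasis_sq]
        simp
    _ = ∑ _ : Fin (Module.finrank ℝ (ℝ ∙ w)ᗮ), zonalFunctional w (X * p) := by
        rw [integral_finsetSum _ fun i _ => integrable_of_continuous (by fun_prop)]
        simp only [integral_const_mul, hb]
    _ = zonalFunctional w (C (N : ℝ) * (X * p)) := by
        rw [map_C_mul, Finset.sum_const, Finset.card_univ, Fintype.card_fin, hdim, nsmul_eq_mul]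

theorem isGegenbauerFunctional_zonalFunctional {N : ℕ}
    (hE : Module.finrank ℝ E = N + 2) {e : E} (he : ‖e‖ = 1) :
    IsGegenbauerFunctional N (zonalFunctional e) where
  map_one := zonalFunctional_one e
  by_parts p := by simpa [he] using zonalFunctional_by_parts (N := N + 1) hE e p
  nonneg p hp := integral_nonneg fun x => hp _ <| by
    have := abs_real_inner_le_norm (x : E) e
    rw [he, norm_eq_of_mem_sphere, one_mul] at this
    exact abs_le.1 this

end Moments

section Zonal

open Polynomial

variable {E : Type*} [NormedAddCommGroup E] [InnerProductSpace ℝ E]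

theorem inner_sphere_mem_Icc (x y : sphere (0 : E) 1) :
    inner ℝ (x : E) (y : E) ∈ Icc (-1 : ℝ) 1 := by
  have h := abs_real_inner_le_norm (x : E) y
  rw [norm_eq_of_mem_sphere, norm_eq_of_mem_sphere, one_mul] at h
  exact abs_le.1 h

variable [FiniteDimensional ℝ E]

theorem finrank_orthogonal_sphere {M : ℕ} (hE : Module.finrank ℝ E = M + 1)
    (x : sphere (0 : E) 1) : Module.finrank ℝ (ℝ ∙ (x : E))ᗮ = M := by
  have h := Submodule.finrank_add_finrank_orthogonal (ℝ ∙ (x : E))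
  rw [finrank_span_singleton (ne_zero_of_mem_unit_sphere x)] at h
  omega

variable [MeasurableSpace E] [BorelSpace E]

theorem norm_sq_orthogonalProjection_sphere (x y : sphere (0 : E) 1) :
    ‖(ℝ ∙ (x : E))ᗮ.orthogonalProjectionOnto (y : E)‖ ^ 2 = 1 - inner ℝ (x : E) (y : E) ^ 2 := by
  have hx : ‖(x : E)‖ = 1 := norm_eq_of_mem_sphere x
  rw [Submodule.coe_norm, proj_val _ hx, norm_sub_sq_real, inner_smul_right, norm_smul, hx,
    norm_eq_of_mem_sphere, real_inner_comm (x : E) (y : E), mul_one, Real.norm_eq_abs, sq_abs]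
  ring

theorem integral_slice_eval_inner (δ : Icc (-1 : ℝ) 1) (x y : sphere (0 : E) 1)
    [Nontrivial (ℝ ∙ (x : E))ᗮ] (p : ℝ[X]) :
    ∫ z, p.eval (inner ℝ (z : E) y) ∂sliceMeasure δ x =
      zonalFunctional ((ℝ ∙ (x : E))ᗮ.orthogonalProjectionOnto (y : E))
        (p.comp (C (δ * inner ℝ (x : E) (y : E)) + C √(1 - (δ : ℝ) ^ 2) * X)) := by
  rw [sliceMeasure, integral_map (continuous_sliceEmb δ x).aemeasurable
    (Continuous.aestronglyMeasurable (by fun_prop)), zonalFunctional_apply]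
  congr with u
  simp only [sliceEmb, inner_add_left, inner_smul_left, eval_comp, eval_add, eval_mul, eval_C,
    eval_X, Submodule.inner_orthogonalProjectionOnto_eq_of_mem_left]
  rfl

theorem isProductFunctional_zonalFunctional [Nontrivial E] {N : ℕ}
    (hE : Module.finrank ℝ E = N + 1) {a c : ℝ} (ha : a ^ 2 ≤ 1) {w : E}
    (hw : ‖w‖ ^ 2 = 1 - c ^ 2) :
    IsProductFunctional N a c
      (zonalFunctional w ∘ₗ (aeval (C (a * c) + C √(1 - a ^ 2) * X)).toLinearMap) where
  map_one := by simp [zonalFunctional_one]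
  by_parts p := by
    set L : ℝ[X] := C (a * c) + C √(1 - a ^ 2) * X with hL
    have hr : (C √(1 - a ^ 2) : ℝ[X]) ^ 2 = 1 - C a ^ 2 := by
      rw [← C_pow, Real.sq_sqrt (sub_nonneg.2 ha), C_sub, C_1, C_pow]
    have hd : derivative (p.comp L) = C √(1 - a ^ 2) * (derivative p).comp L := by
      simp [derivative_comp, hL]
    have h := congrArg (√(1 - a ^ 2) * ·) (zonalFunctional_by_parts hE w (p.comp L))
    simp only [← map_C_mul, hd, hw] at h
    simp only [LinearMap.comp_apply, AlgHom.toLinearMap_apply, ← comp_eq_aeval]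
    convert h using 2
    · simp only [mul_comp, add_comp, sub_comp, C_comp, X_comp, pow_comp, hL]
      simp only [C_sub, C_mul, C_pow, C_1, C_ofNat]
      linear_combination
        (-(1 - C c ^ 2) * (derivative p).comp (C a * C c + C √(1 - a ^ 2) * X)) * hr
    · simp only [mul_comp, sub_comp, C_comp, X_comp, hL]
      ring

theorem integral_slice_gegenbauer {N : ℕ} (hE : Module.finrank ℝ E = N + 2) (hN : N ≠ 0)
    (δ : Icc (-1 : ℝ) 1) (x y : sphere (0 : E) 1) (k : ℕ) :
    ∫ z, (gegenbauer N k).eval (inner ℝ (z : E) y) ∂sliceMeasure δ x =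
      (gegenbauer N k).eval (δ : ℝ) * (gegenbauer N k).eval (inner ℝ (x : E) y) := by
  have := nontrivial_orth (by omega) (x : E)
  have hδ : (δ : ℝ) ^ 2 ≤ 1 := (sq_le_one_iff_abs_le_one _).2 (abs_le.2 δ.2)
  rw [integral_slice_eval_inner]
  exact ((isProductFunctional_zonalFunctional (finrank_orthogonal_sphere hE x) hδ
    (norm_sq_orthogonalProjection_sphere x y)).map_gegenbauer_and_derivative hN k).1

theorem ae_inner_slice (δ : Icc (-1 : ℝ) 1) (x : sphere (0 : E) 1) :
    ∀ᵐ z : sphere (0 : E) 1 ∂sliceMeasure δ x, inner ℝ (x : E) (z : E) = δ := by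
  rw [sliceMeasure, ae_map_iff (continuous_sliceEmb δ x).aemeasurable
    (measurableSet_eq_fun (by fun_prop) (by fun_prop))]
  exact .of_forall fun u => inner_sliceEmb δ x u

theorem integral_inner_mul_inner_eq (f g : ℝ → ℝ) {y z w : sphere (0 : E) 1}
    (h : inner ℝ (w : E) (y : E) = inner ℝ (w : E) (z : E)) :
    ∫ x : sphere (0 : E) 1, f (inner ℝ (x : E) y) * g (inner ℝ (x : E) w) ∂uniformSphere E =
      ∫ x : sphere (0 : E) 1, f (inner ℝ (x : E) z) * g (inner ℝ (x : E) w) ∂uniformSphere E := by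
  set R := (ℝ ∙ ((y : E) - z))ᗮ.reflection
  have hy : R y = z := Submodule.reflection_sub (by simp)
  have hw : R w = w := by
    rw [refl_apply, real_inner_comm, inner_sub_right, h]
    simp
  have hRy (x : E) : inner ℝ (R x) (z : E) = inner ℝ x (y : E) := by
    rw [← hy, LinearIsometryEquiv.inner_map_map]
  have hRw (x : E) : inner ℝ (R x) (w : E) = inner ℝ x (w : E) := by
    conv_lhs => rw [← hw, LinearIsometryEquiv.inner_map_map]
  rw [← integral_uniformSphere_reflection
    (fun x => f (inner ℝ x (z : E)) * g (inner ℝ x (w : E))) ((y : E) - z)]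
  simp only [R, hRy, hRw]

variable {N : ℕ} (hE : Module.finrank ℝ E = N + 2) (hN : N ≠ 0)

include hE hN

/-- The left-hand side depends on `y` only through `⟪y, w⟫`, so `y` can be averaged over the slice
of the sphere on which this inner product is constant. -/
theorem integral_gegenbauer_mul_eval [Nontrivial E] (y w : sphere (0 : E) 1) (k : ℕ) (p : ℝ[X]) :
    ∫ x : sphere (0 : E) 1, (gegenbauer N k).eval (inner ℝ (x : E) y) *
      p.eval (inner ℝ (x : E) w) ∂uniformSphere E =
      (gegenbauer N k).eval (inner ℝ (y : E) w) *
        zonalFunctional (w : E) (gegenbauer N k * p) := by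
  set δ : Icc (-1 : ℝ) 1 := ⟨inner ℝ (w : E) (y : E), inner_sphere_mem_Icc w y⟩
  have := isProb_slice (by omega) δ w
  calc ∫ x : sphere (0 : E) 1, (gegenbauer N k).eval (inner ℝ (x : E) y) *
        p.eval (inner ℝ (x : E) w) ∂uniformSphere E
      = ∫ z, ∫ x : sphere (0 : E) 1, (gegenbauer N k).eval (inner ℝ (x : E) z) *
          p.eval (inner ℝ (x : E) w) ∂uniformSphere E ∂sliceMeasure δ w := by
        rw [integral_congr_ae ((ae_inner_slice δ w).mono fun z hz =>
          integral_inner_mul_inner_eq (fun t => (gegenbauer N k).eval t) (fun t => p.eval t) hz)]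
        simp
    _ = ∫ x : sphere (0 : E) 1, (∫ z, (gegenbauer N k).eval (inner ℝ (z : E) x)
          ∂sliceMeasure δ w) * p.eval (inner ℝ (x : E) w) ∂uniformSphere E := by
        rw [integral_integral_swap (Continuous.integrable_of_hasCompactSupport
          (by unfold Function.uncurry; fun_prop) (HasCompactSupport.of_compactSpace _))]
        simp only [integral_mul_const, real_inner_comm]
    _ = (gegenbauer N k).eval (inner ℝ (y : E) w) *
        zonalFunctional (w : E) (gegenbauer N k * p) := by
        have hw (x : sphere (0 : E) 1) : inner ℝ (w : E) (x : E) = inner ℝ (x : E) w :=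
          real_inner_comm _ _
        simp only [integral_slice_gegenbauer hE hN, zonalFunctional_apply, eval_mul, mul_assoc,
          integral_const_mul, hw, δ]

theorem integral_gegenbauer_mul_self [Nontrivial E] (y w : sphere (0 : E) 1) (k : ℕ) :
    ∫ x : sphere (0 : E) 1, (gegenbauer N k).eval (inner ℝ (x : E) y) *
      (gegenbauer N k).eval (inner ℝ (x : E) w) ∂uniformSphere E =
      (gegenbauer N k).eval (inner ℝ (y : E) w) * gegenbauerNormSq N k := by
  rw [integral_gegenbauer_mul_eval hE hN, 
    (isGegenbauerFunctional_zonalFunctional hE (norm_eq_of_mem_sphere w)).map_gegenbauer_sq hN]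

theorem integral_gegenbauer_mul_of_ne [Nontrivial E] (y w : sphere (0 : E) 1) {j k : ℕ}
    (hjk : j ≠ k) :
    ∫ x : sphere (0 : E) 1, (gegenbauer N j).eval (inner ℝ (x : E) y) *
      (gegenbauer N k).eval (inner ℝ (x : E) w) ∂uniformSphere E = 0 := by
  rw [integral_gegenbauer_mul_eval hE hN,
    (isGegenbauerFunctional_zonalFunctional hE (norm_eq_of_mem_sphere w)).orthogonal hjk, mul_zero]

end Zonal

section Density

open Polynomial NormedSpace

theorem span_gegenbauer (N : ℕ) : Submodule.span ℝ (range (gegenbauer N)) = ⊤ := by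
  set S := Submodule.span ℝ (range (gegenbauer N))
  have hmem (k : ℕ) : gegenbauer N k ∈ S := Submodule.subset_span ⟨k, rfl⟩
  have hX (p : ℝ[X]) (hp : p ∈ S) : X * p ∈ S := by
    refine (Submodule.span_le (p := S.comap (LinearMap.mulLeft ℝ X))).2 ?_ hp
    rintro _ ⟨k, rfl⟩
    rcases k with _ | k
    · simpa using hmem 1
    have h : X * gegenbauer N (k + 1) = (2 * k + 2 + N : ℝ)⁻¹ •
        ((k + 1 + N : ℝ) • gegenbauer N (k + 2) + (k + 1 : ℝ) • gegenbauer N k) := by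
      rw [eq_inv_smul_iff₀ (by positivity)]
      simp only [smul_eq_C_mul, C_add, C_mul, map_natCast, C_1, C_ofNat]
      linear_combination -gegenbauer_recurrence N k
    rw [SetLike.mem_coe, Submodule.mem_comap, LinearMap.mulLeft_apply, h]
    exact S.smul_mem _ (S.add_mem (S.smul_mem _ (hmem _)) (S.smul_mem _ (hmem _)))
  have hpow (m : ℕ) : (X : ℝ[X]) ^ m ∈ S := by
    induction m with
    | zero => simpa using hmem 0
    | succ m ih => rw [pow_succ']; exact hX _ ih
  refine eq_top_iff.2 fun p _ => ?_
  rw [p.as_sum_range_C_mul_X_pow]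
  exact S.sum_mem fun m _ => by rw [← smul_eq_C_mul]; exact S.smul_mem _ (hpow m)

variable {E : Type*} [NormedAddCommGroup E] [InnerProductSpace ℝ E]

/-- The linear form `x ↦ ⟪x, v⟫` as a complex-valued continuous function on the sphere. -/
noncomputable def innerMap (v : E) : C(sphere (0 : E) 1, ℂ) where
  toFun x := (inner ℝ (x : E) v : ℝ)

theorem innerMap_add (v w : E) : innerMap (v + w) = innerMap v + innerMap w := by
  ext x
  simp [innerMap, inner_add_right]

theorem innerMap_smul (r : ℝ) (v : E) : innerMap (r • v) = r • innerMap v := by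
  ext x
  simp [innerMap, inner_smul_right]

theorem aeval_innerMap_apply (v : E) (p : ℝ[X]) (x : sphere (0 : E) 1) :
    aeval (innerMap v) p x = (p.eval (inner ℝ (x : E) v) : ℝ) :=
  calc aeval (innerMap v) p x
      = aeval (innerMap v x) p := (aeval_algHom_apply (ContinuousMap.evalAlgHom ℝ ℂ x) _ p).symm
    _ = _ := aeval_algebraMap_apply_eq_algebraMap_eval _ p

theorem aeval_innerMap_mem_span_gegenbauer (N : ℕ) (y : E) (p : ℝ[X]) :
    aeval (innerMap y) p ∈
      Submodule.span ℂ (range fun k => aeval (innerMap y) (gegenbauer N k)) := by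
  set S := Submodule.span ℂ (range fun k => aeval (innerMap y) (gegenbauer N k))
  have h : Submodule.span ℝ (range (gegenbauer N)) ≤
      (S.restrictScalars ℝ).comap (aeval (innerMap y)).toLinearMap :=
    Submodule.span_le.2 <| range_subset_iff.2 fun k => Submodule.subset_span ⟨k, rfl⟩
  rw [span_gegenbauer] at h
  exact h trivial

theorem innerMap_pow_mem_span_gegenbauer [Nontrivial E] (N : ℕ) (v : E) (m : ℕ) :
    innerMap v ^ m ∈ Submodule.span ℂ
      (⋃ k, range fun y : sphere (0 : E) 1 => aeval (innerMap (y : E)) (gegenbauer N k)) := by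
  obtain ⟨r, y, rfl⟩ : ∃ (r : ℝ) (y : sphere (0 : E) 1), v = r • (y : E) := by
    rcases eq_or_ne v 0 with rfl | hv
    · obtain ⟨y, hy⟩ := exists_norm_eq E zero_le_one
      exact ⟨0, ⟨y, mem_sphere_zero_iff_norm.2 hy⟩, (zero_smul _ _).symm⟩
    · have hv' : ‖v‖ ≠ 0 := norm_ne_zero_iff.2 hv
      exact ⟨‖v‖, ⟨‖v‖⁻¹ • v, by simp [norm_smul, hv']⟩, (smul_inv_smul₀ hv' v).symm⟩
  have h : innerMap (r • (y : E)) ^ m = aeval (innerMap (y : E)) ((C r * X) ^ m) := by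
    simp [innerMap_smul, ← Algebra.smul_def]
  rw [h]
  exact Submodule.span_mono (range_subset_iff.2 fun k => mem_iUnion_of_mem k (mem_range_self y))
    (aeval_innerMap_mem_span_gegenbauer N (y : E) _)

variable [FiniteDimensional ℝ E]

theorem exp_innerMap_apply (v : E) (x : sphere (0 : E) 1) :
    exp (innerMap v) x = Complex.exp (inner ℝ (x : E) v : ℝ) := by
  rw [Complex.exp_eq_exp_ℂ]
  exact map_exp (ContinuousMap.evalAlgHom ℂ ℂ x) (continuous_eval_const x) (innerMap v)

theorem adjoin_exp_innerMap : Subalgebra.toSubmodule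
    (Algebra.adjoin ℂ (range fun v : E => exp (innerMap v))) =
      Submodule.span ℂ (range fun v : E => exp (innerMap v)) := by
  let f : Multiplicative E →* C(sphere (0 : E) 1, ℂ) :=
    { toFun v := exp (innerMap v.toAdd)
      map_one' := by
        ext x
        simp [exp_innerMap_apply]
      map_mul' v w := by rw [toAdd_mul, innerMap_add, exp_add] }
  rw [Algebra.adjoin_eq_span]
  exact congrArg (Submodule.span ℂ ·) (congrArg _ (Submonoid.closure_eq (MonoidHom.mrange f)))

theorem span_exp_innerMap_dense :
    (Submodule.span ℂ (range fun v : E => exp (innerMap v))).topologicalClosure = ⊤ := by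
  set s := range fun v : E => exp (innerMap v)
  have hstar : star s = s := by
    rw [← image_star, ← range_comp]
    congr! with v
    rw [Function.comp_apply, star_exp]
    congr 1
    ext x
    simp [innerMap]
  have hsep : (StarAlgebra.adjoin ℂ s).SeparatesPoints := fun x y hxy => by
    refine ⟨_, ⟨exp (innerMap (x : E)), StarAlgebra.subset_adjoin ℂ s ⟨x, rfl⟩, rfl⟩, ?_⟩
    have h : inner ℝ (y : E) (x : E) ≠ 1 := fun h => hxy <| Subtype.ext <| Eq.symm <|
      (inner_eq_one_iff_of_norm_eq_one (norm_eq_of_mem_sphere y) (norm_eq_of_mem_sphere x)).1 h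
    beta_reduce
    rw [exp_innerMap_apply, exp_innerMap_apply, inner_self_eq_one_of_norm_eq_one
      (norm_eq_of_mem_sphere x), ← Complex.ofReal_exp, ← Complex.ofReal_exp]
    exact fun h' => h (Real.exp_injective (Complex.ofReal_injective h')).symm
  have h : (StarAlgebra.adjoin ℂ s).toSubalgebra = Algebra.adjoin ℂ s := by
    rw [StarAlgebra.adjoin_toSubalgebra, hstar, union_self]
  rw [← adjoin_exp_innerMap, ← h]
  have hdense := congrArg (fun A : StarSubalgebra ℂ C(sphere (0 : E) 1, ℂ) => SetLike.coe A)
    (ContinuousMap.starSubalgebra_topologicalClosure_eq_top_of_separatesPoints _ hsep)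
  exact SetLike.coe_injective hdense

theorem span_gegenbauer_dense [Nontrivial E] (N : ℕ) : (Submodule.span ℂ
    (⋃ k, range fun y : sphere (0 : E) 1 =>
      aeval (innerMap (y : E)) (gegenbauer N k))).topologicalClosure = ⊤ := by
  rw [eq_top_iff, ← span_exp_innerMap_dense]
  refine Submodule.topologicalClosure_minimal _ (Submodule.span_le.2 ?_)
    (Submodule.isClosed_topologicalClosure _)
  rintro _ ⟨v, rfl⟩
  exact (Submodule.isClosed_topologicalClosure _).mem_of_tendsto
    (exp_series_hasSum_exp' (𝕂 := ℂ) (innerMap v)) (.of_forall fun t => Submodule.sum_mem _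
      fun m _ => Submodule.smul_mem _ _
        (Submodule.le_topologicalClosure _ (innerMap_pow_mem_span_gegenbauer N v m)))

end Density

section Harmonic

theorem finiteDimensional_of_card_orthonormal_le {𝕜 V : Type*} [RCLike 𝕜] [NormedAddCommGroup V]
    [InnerProductSpace 𝕜 V] (c : ℕ)
    (h : ∀ (m : ℕ) (v : Fin m → V), Orthonormal 𝕜 v → m ≤ c) : FiniteDimensional 𝕜 V := by
  have hr : Module.rank 𝕜 V ≤ c := rank_le fun s hs => by
    have := FiniteDimensional.span_finset 𝕜 s
    rw [← finrank_span_finset_eq_card hs]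
    exact h _ _ ((stdOrthonormalBasis 𝕜 (Submodule.span 𝕜 (s : Set V))).orthonormal
      |>.comp_linearIsometry (Submodule.subtypeₗᵢ _))
  exact Module.rank_lt_aleph0_iff.1 (hr.trans_lt Cardinal.natCast_lt_aleph0)

theorem exists_hilbertBasis_mem {ι 𝕜 H : Type*} [RCLike 𝕜] [NormedAddCommGroup H]
    [InnerProductSpace 𝕜 H] [CompleteSpace H] {V : ι → Submodule 𝕜 H}
    [∀ k, FiniteDimensional 𝕜 (V k)]
    (hV : OrthogonalFamily 𝕜 (fun k => V k) fun k => (V k).subtypeₗᵢ)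
    (hdense : (⨆ k, V k).topologicalClosure = ⊤) :
    ∃ b : HilbertBasis (Σ k, Fin (Module.finrank 𝕜 (V k))) 𝕜 H, ∀ a, b a ∈ V a.1 := by
  let u k := stdOrthonormalBasis 𝕜 (V k)
  let v (a : Σ k, Fin (Module.finrank 𝕜 (V k))) : H := u a.1 a.2
  have hv : Orthonormal 𝕜 v := hV.orthonormal_sigma_orthonormal fun k => (u k).orthonormal
  have hspan (k : ι) : V k ≤ Submodule.span 𝕜 (range v) :=
    calc V k = (Submodule.span 𝕜 (range (u k).toBasis)).map (V k).subtype := by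
          rw [(u k).toBasis.span_eq, Submodule.map_subtype_top]
      _ ≤ Submodule.span 𝕜 (range v) := by
          rw [Submodule.map_span, ← range_comp]
          exact Submodule.span_mono (range_subset_iff.2 fun i => ⟨⟨k, i⟩, by simp [v]⟩)
  refine ⟨HilbertBasis.mk hv <|
    hdense.ge.trans (Submodule.topologicalClosure_mono (iSup_le hspan)), fun a => ?_⟩
  rw [HilbertBasis.coe_mk]
  exact (u a.1 a.2).2

theorem integral_norm_sq_eq_norm_sq {α 𝕜 F : Type*} [RCLike 𝕜] [MeasurableSpace α]
    {μ : Measure α} [NormedAddCommGroup F] [InnerProductSpace 𝕜 F] (f : Lp F 2 μ) :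
    ∫ x, ‖f x‖ ^ 2 ∂μ = ‖f‖ ^ 2 := by
  rw [← inner_self_eq_norm_sq (𝕜 := 𝕜), L2.inner_def, ← integral_re (L2.integrable_inner f f)]
  simp only [inner_self_eq_norm_sq]

open Polynomial

variable {E : Type*} [NormedAddCommGroup E] [InnerProductSpace ℝ E] [FiniteDimensional ℝ E]
  [MeasurableSpace E] [BorelSpace E] [Nontrivial E]

/-- The zonal function `x ↦ φ_k(⟪x, y⟫)` with pole `y`, as an element of `L²`. -/
noncomputable def zonal (N k : ℕ) (y : sphere (0 : E) 1) : Lp ℂ 2 (uniformSphere E) :=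
  ContinuousMap.toLp 2 (uniformSphere E) ℂ (aeval (innerMap (y : E)) (gegenbauer N k))

variable (E) in
/-- The span of the zonal functions of degree `k`: for `N + 2 = finrank ℝ E` these are the
spherical harmonics of degree `k`. -/
noncomputable def harmonicSpace (N k : ℕ) : Submodule ℂ (Lp ℂ 2 (uniformSphere E)) :=
  Submodule.span ℂ (range (zonal N k))

theorem coeFn_zonal (N k : ℕ) (y : sphere (0 : E) 1) : zonal N k y =ᵐ[uniformSphere E]
    fun x => (((gegenbauer N k).eval (inner ℝ (x : E) y) : ℝ) : ℂ) := by
  filter_upwards [ContinuousMap.coeFn_toLp (p := 2) (𝕜 := ℂ) (uniformSphere E)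
    (aeval (innerMap (y : E)) (gegenbauer N k))] with x hx
  rw [zonal, hx, aeval_innerMap_apply]

theorem iSup_harmonicSpace_dense (N : ℕ) : (⨆ k, harmonicSpace E N k).topologicalClosure = ⊤ := by
  have h := (ContinuousMap.toLp_denseRange ℂ (uniformSphere E) ℂ
    ENNReal.ofNat_ne_top (p := 2)).topologicalClosure_map_submodule (span_gegenbauer_dense N)
  rw [Submodule.map_span, image_iUnion, Submodule.span_iUnion] at h
  simp only [← range_comp] at h
  exact h

theorem inner_zonal_zonal (N j k : ℕ) (y w : sphere (0 : E) 1) :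
    inner ℂ (zonal N j y) (zonal N k w) = ((∫ x : sphere (0 : E) 1,
      (gegenbauer N j).eval (inner ℝ (x : E) y) * (gegenbauer N k).eval (inner ℝ (x : E) w)
      ∂uniformSphere E : ℝ) : ℂ) := by
  simp only [zonal, ContinuousMap.inner_toLp, aeval_innerMap_apply, Complex.conj_ofReal,
    ← Complex.ofReal_mul, integral_complex_ofReal, mul_comm]

variable {N : ℕ} (hE : Module.finrank ℝ E = N + 2) (hN : N ≠ 0)
include hE hN

theorem inner_zonal_zonal_self (k : ℕ) (y w : sphere (0 : E) 1) :
    inner ℂ (zonal N k y) (zonal N k w) =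
      (gegenbauerNormSq N k : ℂ) * ((gegenbauer N k).eval (inner ℝ (y : E) w) : ℝ) := by
  rw [inner_zonal_zonal, integral_gegenbauer_mul_self hE hN, Complex.ofReal_mul, mul_comm]

theorem norm_sq_zonal (k : ℕ) (y : sphere (0 : E) 1) :
    ‖zonal N k y‖ ^ 2 = gegenbauerNormSq N k := by
  rw [← inner_self_eq_norm_sq (𝕜 := ℂ), inner_zonal_zonal_self hE hN, real_inner_self_eq_norm_sq,
    norm_eq_of_mem_sphere, one_pow, gegenbauer_eval_one, Complex.ofReal_one, mul_one]
  exact Complex.ofReal_re _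

theorem orthogonal_harmonicSpace {j k : ℕ} (hjk : j ≠ k) :
    harmonicSpace E N j ⟂ harmonicSpace E N k := by
  rw [harmonicSpace, harmonicSpace, Submodule.isOrtho_span]
  rintro _ ⟨y, rfl⟩ _ ⟨w, rfl⟩
  rw [inner_zonal_zonal, integral_gegenbauer_mul_of_ne hE hN _ _ hjk, Complex.ofReal_zero]

theorem sphereAverage_zonal (δ : Icc (-1 : ℝ) 1) (k : ℕ) (y : sphere (0 : E) 1) :
    sphereAverage (by omega) δ (zonal N k y) =
      (((gegenbauer N k).eval (δ : ℝ) : ℝ) : ℂ) • zonal N k y := by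
  apply Lp.ext
  filter_upwards [coeFn_sphereAverage (by omega) δ (zonal N k y),
    ae_slice (by omega) δ (coeFn_zonal N k y), coeFn_zonal N k y,
    Lp.coeFn_smul (((gegenbauer N k).eval (δ : ℝ) : ℝ) : ℂ) (zonal N k y)] with x hT hslice hx hsmul
  rw [hT, hsmul, Pi.smul_apply, hx, integral_congr_ae hslice, integral_complex_ofReal,
    integral_slice_gegenbauer hE hN, Complex.ofReal_mul, smul_eq_mul]

theorem sphereAverage_of_mem_harmonicSpace (δ : Icc (-1 : ℝ) 1) {k : ℕ}
    {f : Lp ℂ 2 (uniformSphere E)} (hf : f ∈ harmonicSpace E N k) :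
    sphereAverage (by omega) δ f = (((gegenbauer N k).eval (δ : ℝ) : ℝ) : ℂ) • f := by
  induction hf using Submodule.span_induction with
  | mem f hf =>
    obtain ⟨y, rfl⟩ := hf
    exact sphereAverage_zonal hE hN δ k y
  | zero => simp
  | add f g _ _ hf hg => rw [map_add, hf, hg, smul_add]
  | smul r f _ hf => rw [map_smul, hf, smul_comm]

/-- Up to a constant, zonal functions are reproducing kernels. -/
theorem inner_zonal_of_mem_harmonicSpace {k : ℕ} {f : Lp ℂ 2 (uniformSphere E)}
    (hf : f ∈ harmonicSpace E N k) :
    (fun x => inner ℂ (zonal N k x) f) =ᵐ[uniformSphere E]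
      fun x => (gegenbauerNormSq N k : ℂ) * f x := by
  induction hf using Submodule.span_induction with
  | mem f hf =>
    obtain ⟨y, rfl⟩ := hf
    filter_upwards [coeFn_zonal N k y] with x hx
    rw [inner_zonal_zonal_self hE hN, hx]
  | zero =>
    filter_upwards [Lp.coeFn_zero ℂ 2 (uniformSphere E)] with x hx
    rw [hx, inner_zero_right, Pi.zero_apply, mul_zero]
  | add f g _ _ hf hg =>
    filter_upwards [hf, hg, Lp.coeFn_add f g] with x hf hg hadd
    rw [inner_add_right, hf, hg, hadd, Pi.add_apply, mul_add]
  | smul r f _ hf =>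
    filter_upwards [hf, Lp.coeFn_smul r f] with x hf hsmul
    rw [inner_smul_right, hf, hsmul, Pi.smul_apply, smul_eq_mul, mul_left_comm]

theorem card_mul_gegenbauerNormSq_le {k : ℕ} {ι : Type*} [Fintype ι]
    {v : ι → Lp ℂ 2 (uniformSphere E)} (hv : Orthonormal ℂ v)
    (hvk : ∀ i, v i ∈ harmonicSpace E N k) : Fintype.card ι * gegenbauerNormSq N k ≤ 1 := by
  have hpos := gegenbauerNormSq_pos hN k
  have hint (i : ι) : Integrable (fun x => gegenbauerNormSq N k ^ 2 * ‖v i x‖ ^ 2)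
      (uniformSphere E) := ((Lp.memLp (v i)).integrable_norm_pow two_ne_zero).const_mul _
  have hbessel : ∀ᵐ x ∂uniformSphere E,
      ∑ i, gegenbauerNormSq N k ^ 2 * ‖v i x‖ ^ 2 ≤ gegenbauerNormSq N k := by
    filter_upwards [ae_all_iff.2 fun i => inner_zonal_of_mem_harmonicSpace hE hN (hvk i)] with x hx
    have h := hv.sum_inner_products_le (zonal N k x) (s := Finset.univ)
    simpa only [norm_inner_symm (v _), hx, norm_mul, mul_pow, Complex.norm_real, Real.norm_eq_abs,
      sq_abs, norm_sq_zonal hE hN] using h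
  have h := integral_mono_ae (integrable_finsetSum _ fun i _ => hint i) (integrable_const _) hbessel
  simp only [integral_finsetSum _ fun i _ => hint i, integral_const_mul,
    integral_norm_sq_eq_norm_sq (𝕜 := ℂ), hv.1, one_pow, mul_one, Finset.sum_const,
    Finset.card_univ, nsmul_eq_mul, integral_const, probReal_univ, one_smul] at h
  exact le_of_mul_le_mul_right (by linarith) hpos

theorem finiteDimensional_harmonicSpace (k : ℕ) : FiniteDimensional ℂ (harmonicSpace E N k) := by
  refine finiteDimensional_of_card_orthonormal_le (𝕜 := ℂ) ⌊(gegenbauerNormSq N k)⁻¹⌋₊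
    fun m v hv => Nat.le_floor ?_
  have h := card_mul_gegenbauerNormSq_le hE hN
    (hv.comp_linearIsometry (Submodule.subtypeₗᵢ _)) fun i => (v i).2
  rwa [Fintype.card_fin, ← le_div_iff₀ (gegenbauerNormSq_pos hN k), one_div] at h

theorem finrank_harmonicSpace_mul_le (k : ℕ) :
    Module.finrank ℂ (harmonicSpace E N k) * gegenbauerNormSq N k ≤ 1 := by
  have := finiteDimensional_harmonicSpace hE hN k
  have h := card_mul_gegenbauerNormSq_le hE hN
    ((stdOrthonormalBasis ℂ (harmonicSpace E N k)).orthonormal.comp_linearIsometry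
      (Submodule.subtypeₗᵢ _)) fun i => (stdOrthonormalBasis ℂ _ i).2
  rwa [Fintype.card_fin] at h

theorem exists_hilbertBasis_sphereAverage :
    ∃ (d : ℕ → ℕ) (b : HilbertBasis (Σ k, Fin (d k)) ℂ (Lp ℂ 2 (uniformSphere E))),
      (∀ k, d k * gegenbauerNormSq N k ≤ 1) ∧
      ∀ (δ : Icc (-1 : ℝ) 1) (a : Σ k, Fin (d k)), sphereAverage (by omega) δ (b a) =
        (((gegenbauer N a.1).eval (δ : ℝ) : ℝ) : ℂ) • b a := by
  have := finiteDimensional_harmonicSpace hE hN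
  obtain ⟨b, hb⟩ := exists_hilbertBasis_mem
    (OrthogonalFamily.of_pairwise fun j k hjk => orthogonal_harmonicSpace hE hN hjk)
    (iSup_harmonicSpace_dense N)
  exact ⟨fun k => Module.finrank ℂ (harmonicSpace E N k), b, finrank_harmonicSpace_mul_le hE hN,
    fun δ a => sphereAverage_of_mem_harmonicSpace hE hN δ (hb a)⟩

end Harmonic

section Eigenvector

theorem mem_spectrum_of_eigenvector {V : Type*} [NormedAddCommGroup V] [NormedSpace ℂ V]
    {a : V →L[ℂ] V} {v : V} (hv : v ≠ 0) {μ : ℝ} (h : a v = (μ : ℂ) • v) : μ ∈ spectrum ℝ a := by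
  intro hu
  obtain ⟨w, hw⟩ := hu.exists_left_inv
  have hker : (algebraMap ℝ (V →L[ℂ] V) μ - a) v = 0 := by
    simp [Algebra.algebraMap_eq_smul_one, h]
  exact hv (by simpa [hker] using (congrArg (fun u : V →L[ℂ] V => u v) hw).symm)

variable {H : Type*} [NormedAddCommGroup H] [InnerProductSpace ℂ H] [CompleteSpace H]

theorem cfcHom_apply_eigenvector {a : H →L[ℂ] H} (ha : IsSelfAdjoint a) {v : H} {μ : ℝ}
    (h : a v = (μ : ℂ) • v) (hμ : μ ∈ spectrum ℝ a) (g : C(spectrum ℝ a, ℝ)) :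
    cfcHom (R := ℝ) ha g v = (g ⟨μ, hμ⟩ : ℂ) • v := by
  induction g using ContinuousMap.induction_on_of_compact with
  | const r =>
    change cfcHom ha (algebraMap ℝ C(spectrum ℝ a, ℝ) r) v = _
    rw [AlgHomClass.commutes, Algebra.algebraMap_eq_smul_one]
    simp
  | id => rw [cfcHom_id (R := ℝ) ha, h, ContinuousMap.restrict_apply, ContinuousMap.id_apply]
  | star_id =>
    rw [map_star, cfcHom_id ha, ha.star_eq, h]
    rfl
  | add f g hf hg =>
    rw [map_add, add_apply, hf, hg, ← add_smul, ContinuousMap.add_apply, Complex.ofReal_add]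
  | mul f g hf hg =>
    rw [map_mul, mul_apply_eq_comp, hg, map_smul, hf, smul_smul, ContinuousMap.mul_apply,
      Complex.ofReal_mul, mul_comm]
  | frequently f hf =>
    have hc : IsClosed {g | cfcHom (R := ℝ) ha g v = (g ⟨μ, hμ⟩ : ℂ) • v} := isClosed_eq
      ((ContinuousLinearMap.apply ℂ H v).continuous.comp (cfcHom_continuous ha))
      ((Complex.continuous_ofReal.comp (continuous_eval_const _)).smul continuous_const)
    exact hc.closure_subset (mem_closure_of_frequently_of_tendsto hf Filter.tendsto_id)

theorem cfc_apply_eigenvector {a : H →L[ℂ] H} (ha : IsSelfAdjoint a) {v : H} (hv : v ≠ 0) {μ : ℝ}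
    (h : a v = (μ : ℂ) • v) (f : ℝ → ℝ) (hf : ContinuousOn f (spectrum ℝ a)) :
    cfc f a v = (f μ : ℂ) • v := by
  rw [cfc_apply f a ha hf, cfcHom_apply_eigenvector ha h (mem_spectrum_of_eigenvector hv h)]
  rfl

end Eigenvector

section Diagonal

variable {H : Type*} [NormedAddCommGroup H] [InnerProductSpace ℂ H]
  {ι : Type*} {b : HilbertBasis ι ℂ H} {T : H →L[ℂ] H} {c : ι → ℝ}

theorem inner_basis_diagonal (hT : ∀ i, T (b i) = (c i : ℂ) • b i) (i : ι) (x : H) :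
    inner ℂ (b i) (T x) = c i * inner ℂ (b i) x := by
  classical
  have h : (innerSL ℂ (b i)).comp T = (c i : ℂ) • innerSL ℂ (b i) := by
    refine ContinuousLinearMap.ext_on (s := range b)
      (Submodule.dense_iff_topologicalClosure_eq_top.2 b.dense_span) ?_
    rintro _ ⟨j, rfl⟩
    simp only [ContinuousLinearMap.comp_apply, smul_apply, innerSL_apply_apply,
      hT, inner_smul_right, orthonormal_iff_ite.1 b.orthonormal, smul_eq_mul]
    split_ifs with hij
    · rw [hij]
    · rw [mul_zero, mul_zero]
  simpa using congrArg (fun u => u x) h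

variable [CompleteSpace H]

theorem isSelfAdjoint_diagonal (hT : ∀ i, T (b i) = (c i : ℂ) • b i) : IsSelfAdjoint T := by
  rw [ContinuousLinearMap.isSelfAdjoint_iff_isSymmetric]
  intro x y
  rw [ContinuousLinearMap.coe_coe]
  refine (b.hasSum_inner_mul_inner (T x) y).unique ?_
  convert b.hasSum_inner_mul_inner x (T y) using 2 with i
  rw [inner_basis_diagonal hT, ← inner_conj_symm, inner_basis_diagonal hT, map_mul,
    inner_conj_symm, Complex.conj_ofReal]
  ring

theorem norm_diagonal_le (hT : ∀ i, T (b i) = (c i : ℂ) • b i) {C : ℝ} (hC : 0 ≤ C)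
    (hc : ∀ i, |c i| ≤ C) : ‖T‖ ≤ C := by
  refine T.opNorm_le_bound hC fun x => ?_
  have hle (i : ι) : ENNReal.ofReal (‖inner ℂ (b i) (T x)‖ ^ 2) ≤
      ENNReal.ofReal (C ^ 2) * ENNReal.ofReal (‖inner ℂ (b i) x‖ ^ 2) := by
    rw [← ENNReal.ofReal_mul (by positivity), inner_basis_diagonal hT, norm_mul, mul_pow,
      Complex.norm_real, Real.norm_eq_abs]
    gcongr
    exact hc i
  have hsum := ENNReal.tsum_le_tsum hle
  rw [ENNReal.tsum_mul_left, parseval, parseval, ← ENNReal.ofReal_mul (by positivity),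
    ENNReal.ofReal_le_ofReal_iff (by positivity), ← mul_pow] at hsum
  exact le_of_sq_le_sq hsum (by positivity)

theorem norm_diagonal_sub_sum_le (hT : ∀ i, T (b i) = (c i : ℂ) • b i) {C : ℝ} (hC : 0 ≤ C)
    (s : Finset ι) (hc : ∀ i ∉ s, |c i| ≤ C) :
    ‖T - ∑ i ∈ s, ((c i : ℂ) • innerSL ℂ (b i)).smulRight (b i)‖ ≤ C := by
  classical
  have hdiag (i : ι) : (T - ∑ i ∈ s, ((c i : ℂ) • innerSL ℂ (b i)).smulRight (b i)) (b i) =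
      ((if i ∈ s then 0 else c i : ℝ) : ℂ) • b i := by
    rw [sub_apply, hT, sum_apply]
    simp only [ContinuousLinearMap.smulRight_apply, smul_apply, innerSL_apply_apply,
      orthonormal_iff_ite.1 b.orthonormal, smul_eq_mul, mul_ite, mul_one, mul_zero, ite_smul,
      zero_smul, Finset.sum_ite_eq']
    split_ifs <;> simp
  refine norm_diagonal_le hdiag hC fun i => ?_
  split_ifs with hi
  · rwa [abs_zero]
  · exact hc i hi

theorem isCompactOperator_diagonal (hT : ∀ i, T (b i) = (c i : ℂ) • b i)
    (hc : Filter.Tendsto c Filter.cofinite (nhds 0)) : IsCompactOperator T := by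
  classical
  refine isCompactOperator_of_tendsto (l := Filter.atTop)
    (F := fun s : Finset ι => ∑ i ∈ s, ((c i : ℂ) • innerSL ℂ (b i)).smulRight (b i)) ?_
    (.of_forall fun s => (compactOperator (RingHom.id ℂ) H H).sum_mem fun i _ =>
      (isCompactOperator_of_locallyCompactSpace_dom ((c i : ℂ) • innerSL ℂ (b i))).clm_comp
        (ContinuousLinearMap.toSpanSingleton ℂ (b i)))
  rw [Metric.tendsto_atTop]
  intro ε hε
  have hfin : {i | ¬ |c i| < ε / 2}.Finite := by
    simpa using hc.eventually (Metric.ball_mem_nhds 0 (half_pos hε))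
  refine ⟨hfin.toFinset, fun s hs => ?_⟩
  rw [dist_comm, dist_eq_norm]
  refine (norm_diagonal_sub_sum_le hT (half_pos hε).le s fun i hi => ?_).trans_lt
    (half_lt_self hε)
  by_contra h
  exact hi (hs (hfin.mem_toFinset.2 fun hlt => h hlt.le))

theorem posTrace_abs_rpow_diagonal (hT : ∀ i, T (b i) = (c i : ℂ) • b i) {q : ℝ} (hq : 0 ≤ q) :
    posTrace (CFC.abs T ^ q) = ∑' i, ENNReal.ofReal (|c i| ^ q) := by
  have hsa := isSelfAdjoint_diagonal hT
  have hb (i : ι) : b i ≠ 0 := b.orthonormal.ne_zero i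
  have habs (i : ι) : CFC.abs T (b i) = ((|c i| : ℝ) : ℂ) • b i := by
    rw [CFC.abs_eq_cfc_norm T hsa, cfc_apply_eigenvector hsa (hb i) (hT i) _ (by fun_prop),
      Real.norm_eq_abs]
  rw [posTrace_eq b CFC.rpow_nonneg]
  congr with i
  rw [CFC.rpow_eq_cfc_real, cfc_apply_eigenvector (CFC.abs_nonneg T).isSelfAdjoint (hb i) (habs i)
    _ (Real.continuous_rpow_const hq).continuousOn, inner_smul_right,
    inner_self_eq_norm_sq_to_K, b.orthonormal.1 i]
  simp

theorem schattenNorm_diagonal (hT : ∀ i, T (b i) = (c i : ℂ) • b i) {p : ℝ≥0∞} (hp : p ≠ ∞) :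
    schattenNorm p T = (∑' i, ENNReal.ofReal (|c i| ^ p.toReal)) ^ (1 / p.toReal) := by
  rw [schattenNorm, if_neg hp, posTrace_abs_rpow_diagonal hT ENNReal.toReal_nonneg]

theorem tendsto_cofinite_of_tsum_rpow_ne_top {q : ℝ} (hq : 0 < q)
    (h : ∑' i, ENNReal.ofReal (|c i| ^ q) ≠ ∞) : Filter.Tendsto c Filter.cofinite (nhds 0) := by
  have hpow : Filter.Tendsto (fun i => |c i| ^ q) Filter.cofinite (nhds 0) := by
    refine ((ENNReal.tendsto_toReal ENNReal.zero_ne_top).comp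
      (ENNReal.tendsto_cofinite_zero_of_tsum_ne_top h)).congr fun i => ?_
    exact ENNReal.toReal_ofReal (by positivity)
  have hroot := hpow.rpow_const (.inr (inv_nonneg.2 hq.le))
  rw [Real.zero_rpow (inv_pos.2 hq).ne'] at hroot
  exact (tendsto_zero_iff_abs_tendsto_zero c).2
    (hroot.congr fun i => Real.rpow_rpow_inv (abs_nonneg _) hq.ne')

theorem tsum_rpow_le_of_tsum_rpow_le {q r B : ℝ} (hq : 0 < q) (hqr : q ≤ r) (hB : 0 ≤ B)
    (hcB : ∀ i, |c i| ≤ B) (h : ∑' i, ENNReal.ofReal (|c i| ^ q) ≤ ENNReal.ofReal (B ^ q)) :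
    ∑' i, ENNReal.ofReal (|c i| ^ r) ≤ ENNReal.ofReal (B ^ r) := by
  have hsplit {x : ℝ} (hx : 0 ≤ x) : x ^ r = x ^ q * x ^ (r - q) := by
    rw [← Real.rpow_add_of_nonneg hx hq.le (sub_nonneg.2 hqr), add_sub_cancel]
  calc ∑' i, ENNReal.ofReal (|c i| ^ r)
      ≤ ∑' i, ENNReal.ofReal (|c i| ^ q) * ENNReal.ofReal (B ^ (r - q)) := by
        refine ENNReal.tsum_le_tsum fun i => ?_
        rw [hsplit (abs_nonneg _), ENNReal.ofReal_mul (by positivity)]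
        gcongr
        exact hcB i
    _ ≤ ENNReal.ofReal (B ^ q) * ENNReal.ofReal (B ^ (r - q)) := by
        rw [ENNReal.tsum_mul_right]
        gcongr
    _ = ENNReal.ofReal (B ^ r) := by
        rw [← ENNReal.ofReal_mul (by positivity), ← hsplit hB]

theorem memSchatten_diagonal_and_schattenNorm_le (hT : ∀ i, T (b i) = (c i : ℂ) • b i)
    {p : ℝ≥0∞} {q B : ℝ} (hq : 0 < q) (hqp : ENNReal.ofReal q ≤ p) (hB : 0 ≤ B)
    (h : ∑' i, ENNReal.ofReal (|c i| ^ q) ≤ ENNReal.ofReal (B ^ q)) :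
    MemSchatten p T ∧ schattenNorm p T ≤ ENNReal.ofReal B := by
  have hcB (i : ι) : |c i| ≤ B := by
    have hi := (ENNReal.le_tsum i).trans h
    rwa [ENNReal.ofReal_le_ofReal_iff (by positivity),
      Real.rpow_le_rpow_iff (abs_nonneg _) hB hq] at hi
  rcases eq_or_ne p ∞ with rfl | hp
  · rw [MemSchatten, schattenNorm, if_pos rfl, if_pos rfl, ← ofReal_norm]
    exact ⟨isCompactOperator_diagonal hT
      (tendsto_cofinite_of_tsum_rpow_ne_top hq (h.trans_lt ENNReal.ofReal_lt_top).ne),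
      ENNReal.ofReal_le_ofReal (norm_diagonal_le hT hB hcB)⟩
  · have hqr : q ≤ p.toReal := (ENNReal.ofReal_le_iff_le_toReal hp).1 hqp
    have hr : 0 < p.toReal := hq.trans_le hqr
    have hle : schattenNorm p T ≤ ENNReal.ofReal B :=
      calc schattenNorm p T
          = (∑' i, ENNReal.ofReal (|c i| ^ p.toReal)) ^ (1 / p.toReal) :=
            schattenNorm_diagonal hT hp
        _ ≤ ENNReal.ofReal (B ^ p.toReal) ^ (1 / p.toReal) := by
            gcongr
            exact tsum_rpow_le_of_tsum_rpow_le hq hqr hB hcB h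
        _ = ENNReal.ofReal B := by
            rw [← ENNReal.ofReal_rpow_of_nonneg hB hr.le, one_div, ENNReal.rpow_rpow_inv hr.ne']
    exact ⟨by rw [MemSchatten, if_neg hp]; exact hle.trans_lt ENNReal.ofReal_lt_top, hle⟩

end Diagonal

section Bounds

theorem mul_rpow_le_of_sqrt_bound {N : ℕ} {d h K M l x α q : ℝ} (hh : 0 < h) (hx : 0 < x)
    (hM : 0 ≤ M) (hd : d * h ≤ 1) (hle : h ≤ K / x ^ N) (hq : 2 ≤ q)
    (hl : |l| ≤ M * (√h * x ^ α)) :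
    d * |l| ^ q ≤ M ^ q * (K ^ (q / 2 - 1) * x ^ (α * q - N * (q / 2 - 1))) := by
  have hK : 0 < K := by simpa using (lt_div_iff₀ (by positivity)).1 (hh.trans_le hle)
  have hlq : |l| ^ q ≤ M ^ q * (h ^ (q / 2) * x ^ (α * q)) := by
    refine (Real.rpow_le_rpow (abs_nonneg _) hl (by linarith)).trans_eq ?_
    rw [Real.mul_rpow hM (by positivity), Real.mul_rpow (by positivity) (by positivity),
      Real.sqrt_eq_rpow, ← Real.rpow_mul hh.le, ← Real.rpow_mul hx.le, one_div_mul_eq_div]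
  have hdh : d ≤ h⁻¹ := by rwa [← one_div, le_div_iff₀ hh]
  have hhq : h ^ (q / 2 - 1) ≤ K ^ (q / 2 - 1) * x ^ (-(N * (q / 2 - 1))) := by
    refine (Real.rpow_le_rpow hh.le hle (by linarith)).trans_eq ?_
    rw [Real.div_rpow hK.le (by positivity), ← Real.rpow_natCast, ← Real.rpow_mul hx.le,
      Real.rpow_neg hx.le, div_eq_mul_inv]
  calc d * |l| ^ q ≤ h⁻¹ * (M ^ q * (h ^ (q / 2) * x ^ (α * q))) :=
        mul_le_mul hdh hlq (by positivity) (by positivity)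
    _ = M ^ q * (h ^ (q / 2 - 1) * x ^ (α * q)) := by
        rw [Real.rpow_sub_one hh.ne']
        ring
    _ ≤ M ^ q * ((K ^ (q / 2 - 1) * x ^ (-(N * (q / 2 - 1)))) * x ^ (α * q)) := by gcongr
    _ = M ^ q * (K ^ (q / 2 - 1) * x ^ (α * q - N * (q / 2 - 1))) := by
        rw [mul_assoc (K ^ (q / 2 - 1)), ← Real.rpow_add hx, neg_add_eq_sub]

theorem exists_tsum_rpow_le {N : ℕ} {d : ℕ → ℕ} {h : ℕ → ℝ} {K α q : ℝ} (hh : ∀ k, 0 < h k)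
    (hd : ∀ k, d k * h k ≤ 1) (hle : ∀ k, h k ≤ K / (k + 1 : ℝ) ^ N) (hq : 2 ≤ q)
    (hα : 1 + α * q < N * (q / 2 - 1)) :
    ∃ S : ℝ, 0 ≤ S ∧ ∀ (l : ℕ → ℝ) (M : ℝ), 0 ≤ M →
      (∀ k : ℕ, |l k| ≤ M * (√(h k) * (k + 1 : ℝ) ^ α)) →
      ∑' a : Σ k, Fin (d k), ENNReal.ofReal (|l a.1| ^ q) ≤ ENNReal.ofReal (M ^ q * S) := by
  have hK : 0 ≤ K := by simpa using ((hh 0).trans_le (hle 0)).le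
  let w (k : ℕ) : ℝ := K ^ (q / 2 - 1) * (k + 1 : ℝ) ^ (α * q - N * (q / 2 - 1))
  have hw (k : ℕ) : 0 ≤ w k := by positivity
  have hsummable : Summable w := by
    have h := (summable_nat_add_iff 1).2
      (Real.summable_nat_rpow (p := α * q - N * (q / 2 - 1)) |>.2 (by linarith))
    push_cast at h
    exact h.mul_left _
  refine ⟨∑' k, w k, tsum_nonneg hw, fun l M hM hl => ?_⟩
  rw [← tsum_mul_left, ENNReal.ofReal_tsum_of_nonneg (fun k => mul_nonneg (by positivity) (hw k))
    (hsummable.mul_left _), ENNReal.tsum_sigma']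
  refine ENNReal.tsum_le_tsum fun k => ?_
  simp only [tsum_fintype, Finset.sum_const, Finset.card_univ, Fintype.card_fin, nsmul_eq_mul]
  rw [← ENNReal.ofReal_natCast, ← ENNReal.ofReal_mul (by positivity)]
  exact ENNReal.ofReal_le_ofReal (mul_rpow_le_of_sqrt_bound (hh k) (by positivity) hM (hd k)
    (hle k) hq (hl k))

theorem exists_schattenNorm_diagonal_le {H : Type*} [NormedAddCommGroup H] [InnerProductSpace ℂ H]
    [CompleteSpace H] {N : ℕ} (hN : N ≠ 0) {d : ℕ → ℕ} {h : ℕ → ℝ} {K : ℝ} (hh : ∀ k, 0 < h k)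
    (hd : ∀ k, d k * h k ≤ 1) (hle : ∀ k, h k ≤ K / (k + 1 : ℝ) ^ N)
    (b : HilbertBasis (Σ k, Fin (d k)) ℂ H) {p : ℝ≥0∞} (hp : ENNReal.ofReal (2 + 2 / N) < p) :
    ∃ C α : ℝ, 0 < α ∧ α < 1 ∧ ∀ (T : H →L[ℂ] H) (l : ℕ → ℝ) (M : ℝ), 0 ≤ M →
      (∀ a, T (b a) = (l a.1 : ℂ) • b a) →
      (∀ k : ℕ, |l k| ≤ M * (√(h k) * (k + 1 : ℝ) ^ α)) →
      MemSchatten p T ∧ schattenNorm p T ≤ ENNReal.ofReal (C * M) := by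
  have hN' : (0 : ℝ) < N := by positivity
  obtain ⟨q, -, hNq, hqp⟩ := ENNReal.lt_iff_exists_real_btwn.1 hp
  replace hNq : 2 + 2 / N < q := (ENNReal.ofReal_lt_ofReal_iff_of_nonneg (by positivity)).1 hNq
  have hq : 2 < q := (lt_add_of_pos_right 2 (by positivity)).trans hNq
  have hgap : 0 < N * (q / 2 - 1) - 1 := by
    rw [← lt_sub_iff_add_lt', div_lt_iff₀ hN'] at hNq
    linarith
  obtain ⟨α, hα0, hα⟩ := exists_between
    (lt_min zero_lt_one (div_pos hgap (by linarith : 0 < q)))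
  rw [lt_min_iff, lt_div_iff₀ (by linarith)] at hα
  obtain ⟨S, hS, hbound⟩ := exists_tsum_rpow_le hh hd hle hq.le (α := α) (by linarith)
  refine ⟨S ^ q⁻¹, α, hα0, hα.1, fun T l M hM hT hl => ?_⟩
  refine memSchatten_diagonal_and_schattenNorm_le hT (by linarith) hqp.le (by positivity) ?_
  rw [Real.mul_rpow (by positivity) hM, Real.rpow_inv_rpow hS (by linarith), mul_comm]
  exact hbound l M hM hl

end Bounds

end SphereMean

open SphereMean in
theorem proposition3p1_general {E : Type*} [NormedAddCommGroup E] [InnerProductSpace ℝ E]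
    [FiniteDimensional ℝ E] [MeasurableSpace E] [BorelSpace E] (hE : 3 ≤ Module.finrank ℝ E)
    (p : ℝ≥0∞) (hp : ENNReal.ofReal (2 + 2 / ((Module.finrank ℝ E : ℝ) - 2)) < p) :
    (∀ δ : Icc (-1 : ℝ) 1, |(δ : ℝ)| < 1 → MemSchatten p (sphereAverage (E := E) (by omega) δ)) ∧
    ∃ C α : ℝ, 2 ≤ C ∧ 0 < α ∧ α < 1 ∧ ∀ δ : Icc (-1 : ℝ) 1, |(δ : ℝ)| ≤ 1 / 2 →
      MemSchatten p
        (sphereAverage (E := E) (by omega) ⟨0, by norm_num⟩ - sphereAverage (by omega) δ) ∧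
      schattenNorm p
        (sphereAverage (E := E) (by omega) ⟨0, by norm_num⟩ - sphereAverage (by omega) δ) ≤
          ENNReal.ofReal (C * |(δ : ℝ)| ^ α) := by
  obtain ⟨N, hEN⟩ : ∃ N, Module.finrank ℝ E = N + 2 := ⟨_, (Nat.sub_add_cancel (by omega)).symm⟩
  have hN : N ≠ 0 := by omega
  have : Nontrivial E := Module.nontrivial_of_finrank_pos (R := ℝ) (by omega)
  obtain ⟨e, he⟩ := exists_norm_eq E zero_le_one
  have hI := isGegenbauerFunctional_zonalFunctional hEN he
  obtain ⟨d, b, hd, hb⟩ := exists_hilbertBasis_sphereAverage (E := E) hEN hN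
  obtain ⟨C, α, hα0, hα1, hbound⟩ := exists_schattenNorm_diagonal_le (p := p) hN
    (gegenbauerNormSq_pos hN) hd (gegenbauerNormSq_le hN) b (by simpa [hEN] using hp)
  refine ⟨fun δ hδ => ?_, max 2 (C * (2 * √((N + 1) * 2 ^ (N + 2)))), α, le_max_left _ _, hα0, hα1,
    fun δ hδ => ?_⟩
  · refine (hbound _ (fun k => (gegenbauer N k).eval (δ : ℝ))
      √(2 * (N + 1) / (1 - (δ : ℝ) ^ 2) ^ (N + 1)) (Real.sqrt_nonneg _) (hb δ) fun k => ?_).1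
    refine (hI.abs_eval_le hN k hδ).trans ?_
    rw [Real.sqrt_mul' _ (gegenbauerNormSq_pos hN k).le]
    gcongr
    exact le_mul_of_one_le_right (Real.sqrt_nonneg _) (Real.one_le_rpow (by simp) hα0.le)
  · refine (hbound _ (fun k => (gegenbauer N k).eval 0 - (gegenbauer N k).eval (δ : ℝ))
      (2 * √((N + 1) * 2 ^ (N + 2)) * |(δ : ℝ)| ^ α) (by positivity) (fun a => ?_)
      fun k => hI.abs_eval_sub_le hN k hδ hα0.le hα1.le).imp_right
      fun h => h.trans (ENNReal.ofReal_le_ofReal ?_)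
    · rw [sub_apply, hb, hb, Complex.ofReal_sub, sub_smul]
    · rw [← mul_assoc]
      exact mul_le_mul_of_nonneg_right (le_max_right _ _) (by positivity)

theorem proposition3p1 (n : ℕ) (hn : 3 ≤ n) (p : ℝ≥0∞)
    (hp : ENNReal.ofReal (2 + 2 / ((n : ℝ) - 2)) < p) :
    (∀ δ : Set.Icc (-1 : ℝ) 1, |(δ : ℝ)| < 1 →
      SphereMean.MemSchatten p (SphereMean.avgOp n hn δ)) ∧
    ∃ C α : ℝ, 2 ≤ C ∧ 0 < α ∧ α < 1 ∧
      ∀ δ : Set.Icc (-1 : ℝ) 1, |(δ : ℝ)| ≤ 1 / 2 →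
        SphereMean.MemSchatten p
          (SphereMean.avgOp n hn ⟨0, by norm_num⟩ - SphereMean.avgOp n hn δ) ∧
        SphereMean.schattenNorm p
          (SphereMean.avgOp n hn ⟨0, by norm_num⟩ - SphereMean.avgOp n hn δ) ≤
            ENNReal.ofReal (C * |(δ : ℝ)| ^ α) := by
  exact proposition3p1_general (E := EuclideanSpace ℝ (Fin n)) (by simpa using hn) p
    (by simpa using hp)
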